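/- Let $S$ be a finite set of points in the Euclidean plane, no three of which are collinear, and let $k\ge 1$ be an integer. A family of $k$ layers of $S$ is a family $H_1,\dots,H_k$ of pairwise edge-disjoint graphs with vertex set $S$ such that each $H_i$ is connected and plane, i.e. when its edges are drawn as straight segments, any two distinct edges of $H_i$ meet at most in a common endpoint. Let $\mathrm{MST}(S)$ be a Euclidean minimum spanning tree of $S$, and let $\mathrm{BE}(\mathrm{MST}(S))$ be the length of its longest edge. (a) If $|S|\ge 4(3k-1)+1$, then $S$ has $k$ layers all of whose edges have length at most $12\sqrt2\,k\,\mathrm{BE}(\mathrm{MST}(S))$. (b) Such layers can be determined locally from an upper bound on $\mathrm{BE}(\mathrm{MST}(S))$: there are an absolute constant $C>0$ and a single rule $R$ with the following property. For all $k\ge1$, all $\beta\in\mathbb R$ and all finite point sets $S$ with no three points collinear, $|S|\ge 4(3k-1)+1$ and $\beta\ge\mathrm{BE}(\mathrm{MST}(S))$, there are $k$ layers $H_1,\dots,H_k$ of $S$ all of whose edges have length at most $12\sqrt2\,k\,\beta$ and such that, for each $i$ and each $p\in S$, the set of neighbours of $p$ in $H_i$ is obtained by applying $R$ to $k$, $\beta$,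 $i$, the point $p$ and the set of those points of $S$ that are at distance at most $C k\beta$ from $p$. -/

import Mathlib

namespace PlaneLayers

/-- The Euclidean plane. -/
abbrev Plane : Type := EuclideanSpace ℝ (Fin 2)

/-- No three distinct points of `S` are collinear. -/
def GeneralPosition (S : Finset Plane) : Prop :=
  ∀ a ∈ S, ∀ b ∈ S, ∀ c ∈ S, a ≠ b → b ≠ c → a ≠ c → ¬ Collinear ℝ {a, b, c}

/-- The Euclidean length of a straight-line edge on the point set `S`. -/
noncomputable def edgeLength {S : Finset Plane} : Sym2 S → ℝ :=
  Sym2.lift ⟨fun a b => dist (a : Plane) b, fun a b => dist_comm (a : Plane) b⟩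

/-- The total edge length of a geometric graph on `S` (a finite sum, since `S` is finite). -/
noncomputable def weight {S : Finset Plane} (H : SimpleGraph S) : ℝ :=
  ∑ᶠ e ∈ H.edgeSet, edgeLength e

/-- `T` is a Euclidean minimum spanning tree of `S`. -/
def IsMST {S : Finset Plane} (T : SimpleGraph S) : Prop :=
  T.IsTree ∧ ∀ T' : SimpleGraph S, T'.IsTree → weight T ≤ weight T'

/-- The length of the longest edge of a geometric graph on `S`. -/
noncomputable def bottleneck {S : Finset Plane} (H : SimpleGraph S) : ℝ :=
  sSup (edgeLength '' H.edgeSet)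

/-- The straight-line drawing is plane: two distinct edges meet at most in a common endpoint. -/
def IsPlane {S : Finset Plane} (H : SimpleGraph S) : Prop :=
  ∀ a b c d : S, H.Adj a b → H.Adj c d → s(a, b) ≠ s(c, d) →
    segment ℝ (a : Plane) b ∩ segment ℝ (c : Plane) d ⊆
      ({(a : Plane), (b : Plane)} ∩ {(c : Plane), (d : Plane)} : Set Plane)

/-- The graphs `H i` are layers of `S`: pairwise edge-disjoint plane connected graphs, each having
all of `S` as its vertex set. -/
structure AreLayers {S : Finset Plane} {k : ℕ} (H : Fin k → SimpleGraph S) : Prop where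
  connected : ∀ i, (H i).Connected
  plane : ∀ i, IsPlane (H i)
  disjoint : ∀ i j, i ≠ j → Disjoint (H i).edgeSet (H j).edgeSet

open Classical in
/-- What the point `p` sees of `S` within distance `r`. -/
noncomputable def localView (S : Finset Plane) (p : Plane) (r : ℝ) : Finset Plane :=
  S.filter fun q => dist p q ≤ r

/-- A local rule: from `k`, the parameter `β`, a finite set of visible points, a point `p` and a
layer index it produces the set of neighbours of `p` in that layer. -/
abbrev LocalRule : Type :=
  (k : ℕ) → (β : ℝ) → (visible : Finset Plane) → (p : Plane) → (i : Fin k) → Set Plane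

/-- In every layer, each point of `S` obtains its neighbours by applying the rule `R` to `β` and
to the points of `S` within distance `r`. -/
def ComputedLocally (R : LocalRule) (β r : ℝ) {S : Finset Plane} {k : ℕ}
    (H : Fin k → SimpleGraph S) : Prop :=
  ∀ (i : Fin k) (p q : S), (H i).Adj p q ↔ (q : Plane) ∈ R k β (localView S p r) p i

end PlaneLayers

/-! Let t = kβ, where β bounds the edges of the tree. Call a point dense if at least 3k points of S
lie within 3t/2 of it. The middle of a tree path with 2⌊3k/2⌋+1 vertices is dense, and so every
point of S is within 3t of a dense one (`exists_dense_near`). The sites form a maximal 6t-separated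
net of dense points, hence every point is within 9t of a site.

Helly's theorem gives a centre c for 3k points near a site; sorting these points by angle about c
yields k vertex-disjoint triangles around c, one per layer (`exists_isFan`). In layer i each point
of the Voronoi cell of the site is joined to the triangle vertex (hub) whose angular sector at c
contains it. The sectors cover the cell, which connects it, and they are disjoint, which prevents
crossings.

Cells are linked by bridges between hubs that lie in each other's sectors (`exists_mutual_inArc`),
one for each edge of the relative neighbourhood graph of the sites cut off at length 27t/2. That
graph is connected because tree paths pass from site to site by jumps of at most 13t
(`exists_cross_pair`). A bridge stays in the two Voronoi cells of its sites since 6t = 4 · 3t/2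
(`dist_lt_of_mem_thick_segment`). So two edges of a layer that share a site are separated by
sectors, and two that do not are separated by Voronoi cells (`Edge.inter`). Edges of different
layers differ because their hubs do (`Edge.layer_eq`).

An edge has length at most 27t/2 + 2 · 3t/2 = 33t/2 ≤ 12√2 t. Every choice is made by
`Classical.epsilon` from a predicate determined by nearby points, and the net is built in nine
rounds of bounded reach, so the construction is local. -/

namespace PlaneLayers

/-! ### Angular sectors of a triangle around a centre. -/

/-- Twice the signed area of the triangle `c x y`. -/
def det (c x y : Plane) : ℝ := (x 0 - c 0) * (y 1 - c 1) - (x 1 - c 1) * (y 0 - c 0)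

/-- `y` lies in the half-open angular sector at `c` from `h j` (exclusive) counterclockwise to the
next vertex of the triangle `h` (inclusive, but only at the vertex itself). -/
def InArc (c : Plane) (h : Fin 3 → Plane) (j : Fin 3) (y : Plane) : Prop :=
  0 < det c (h j) y ∧ (y = h (j + 1) ∨ 0 < det c y (h (j + 1)))

lemma det_swap (c x y : Plane) : det c y x = -det c x y := by unfold det; ring

lemma det_self (c x : Plane) : det c x x = 0 := by unfold det; ring

lemma det_left_self (c y : Plane) : det c c y = 0 := by unfold det; ring

lemma plane_ext {x y : Plane} (h0 : x 0 = y 0) (h1 : x 1 = y 1) : x = y := by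
  ext i; fin_cases i <;> assumption

/-- Three-term Plücker relation for the vectors from `c`. It turns known orientations into a missing
one. -/
lemma det_mul_add (c p q r s : Plane) :
    det c p q * det c r s + det c p r * det c s q + det c p s * det c q r = 0 := by
  unfold det; ring

lemma cyclic_sum_det (c : Plane) (h : Fin 3 → Plane) (y : Plane) :
    det c (h 1) (h 2) * det c (h 0) y + det c (h 2) (h 0) * det c (h 1) y
      + det c (h 0) (h 1) * det c (h 2) y = 0 := by
  unfold det; ring

/-- Otherwise nonnegativity propagates around the 3-cycle, so the three values are all nonnegative
or all negative. By `cyclic_sum_det` they have vanishing sum with positive weights, which leaves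
only the excluded case of three zeros. -/
lemma exists_sign_change {c : Plane} {h : Fin 3 → Plane}
    (hpos : ∀ j, 0 < det c (h j) (h (j + 1))) (y : Plane)
    (hy : ∃ j, det c (h j) y ≠ 0) :
    ∃ j, 0 ≤ det c (h j) y ∧ det c (h (j + 1)) y < 0 := by
  by_contra! H
  have h01 : 0 < det c (h 0) (h 1) := hpos 0
  have h12 : 0 < det c (h 1) (h 2) := hpos 1
  have h20 : 0 < det c (h 2) (h 0) := hpos 2
  have s := cyclic_sum_det c h y
  have H0 : 0 ≤ det c (h 0) y → 0 ≤ det c (h 1) y := H 0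
  have H1 : 0 ≤ det c (h 1) y → 0 ≤ det c (h 2) y := H 1
  have H2 : 0 ≤ det c (h 2) y → 0 ≤ det c (h 0) y := H 2
  by_cases a0 : 0 ≤ det c (h 0) y
  · have a1 := H0 a0
    have a2 := H1 a1
    have m0 := mul_nonneg h12.le a0
    have m1 := mul_nonneg h20.le a1
    have m2 := mul_nonneg h01.le a2
    have e0 : det c (h 0) y = 0 := by
      have : det c (h 1) (h 2) * det c (h 0) y = 0 := by linarith
      rcases mul_eq_zero.1 this with h | h <;> linarith
    have e1 : det c (h 1) y = 0 := by
      have : det c (h 2) (h 0) * det c (h 1) y = 0 := by linarith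
      rcases mul_eq_zero.1 this with h | h <;> linarith
    have e2 : det c (h 2) y = 0 := by
      have : det c (h 0) (h 1) * det c (h 2) y = 0 := by linarith
      rcases mul_eq_zero.1 this with h | h <;> linarith
    obtain ⟨j, hj⟩ := hy
    fin_cases j <;> simp_all
  · have a2 : ¬ 0 ≤ det c (h 2) y := fun h => a0 (H2 h)
    have a1 : ¬ 0 ≤ det c (h 1) y := fun h => a2 (H1 h)
    push Not at a0 a1 a2
    have m0 := mul_neg_of_pos_of_neg h12 a0
    have m1 := mul_neg_of_pos_of_neg h20 a1
    have m2 := mul_neg_of_pos_of_neg h01 a2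
    linarith

lemma exists_inArc {c : Plane} {h : Fin 3 → Plane}
    (hpos : ∀ j, 0 < det c (h j) (h (j + 1))) {y : Plane}
    (hy : ∀ j, y ≠ h j → det c (h j) y ≠ 0) : ∃ j, InArc c h j y := by
  by_cases hv : ∃ j, y = h j
  · obtain ⟨j, rfl⟩ := hv
    -- A vertex belongs to the sector that ends at it, and `j + 2` is the predecessor of `j` modulo
    -- 3.
    refine ⟨j + 2, ?_, Or.inl ?_⟩
    · have := hpos (j + 2)
      have e : j + 2 + 1 = j := by fin_cases j <;> rfl
      rwa [e] at this
    · have e : j + 2 + 1 = j := by fin_cases j <;> rfl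
      rw [e]
  · push Not at hv
    obtain ⟨j, h1, h2⟩ := exists_sign_change hpos y ⟨0, hy 0 (hv 0)⟩
    refine ⟨j, lt_of_le_of_ne h1 (hy j (hv j)).symm, Or.inr ?_⟩
    rw [det_swap]; linarith

lemma mem_segment_coord {x y z : Plane} (hz : z ∈ segment ℝ x y) :
    ∃ s : ℝ, 0 ≤ s ∧ s ≤ 1 ∧ z 0 = x 0 + s * (y 0 - x 0) ∧ z 1 = x 1 + s * (y 1 - x 1) := by
  obtain ⟨a, b, ha, hb, hab, rfl⟩ := hz
  refine ⟨b, hb, by linarith, ?_, ?_⟩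
  · simp only [PiLp.add_apply, PiLp.smul_apply, smul_eq_mul]
    linear_combination (x 0) * hab
  · simp only [PiLp.add_apply, PiLp.smul_apply, smul_eq_mul]
    linear_combination (x 1) * hab

lemma InArc.ne {c : Plane} {h : Fin 3 → Plane} {j : Fin 3} {y : Plane} (hy : InArc c h j y) :
    h j ≠ y := by
  rintro rfl
  exact absurd hy.1 (by rw [det_self]; exact lt_irrefl _)

/-- Both determinants are affine along the segment, so their signs at the two ends decide; the
alternatives record the ends where one may vanish. -/
lemma InArc.of_mem_segment {c : Plane} {h : Fin 3 → Plane}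
    (hpos : ∀ j, 0 < det c (h j) (h (j + 1))) {j : Fin 3} {y z : Plane} (hy : InArc c h j y)
    (hz : z ∈ segment ℝ (h j) y) :
    (z = h j ∨ 0 < det c (h j) z) ∧ ((z = y ∧ y = h (j + 1)) ∨ 0 < det c z (h (j + 1))) := by
  obtain ⟨s, hs0, hs1, e0, e1⟩ := mem_segment_coord hz
  have d1 : det c (h j) z = s * det c (h j) y := by unfold det; rw [e0, e1]; ring
  have d2 : det c z (h (j + 1)) =
      (1 - s) * det c (h j) (h (j + 1)) + s * det c y (h (j + 1)) := by
    unfold det; rw [e0, e1]; ring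
  constructor
  · rcases hs0.eq_or_lt with rfl | hs
    · left; exact plane_ext (by rw [e0]; ring) (by rw [e1]; ring)
    · right; rw [d1]; exact mul_pos hs hy.1
  · have hp := hpos j
    rcases hy.2 with h' | h'
    · rcases hs1.eq_or_lt with rfl | hs
      · left; exact ⟨plane_ext (by rw [e0]; ring) (by rw [e1]; ring), h'⟩
      · right
        rw [d2]
        have : det c y (h (j + 1)) = 0 := by rw [← h', det_self]
        rw [this, mul_zero, add_zero]
        exact mul_pos (by linarith) hp
    · right
      rw [d2]
      rcases hs0.eq_or_lt with rfl | hs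
      · simpa using hp
      · have := mul_pos hs h'
        have := mul_nonneg (sub_nonneg.2 hs1) hp.le
        linarith

lemma InArc.inter_succ {c : Plane} {h : Fin 3 → Plane}
    (hpos : ∀ j, 0 < det c (h j) (h (j + 1))) {j : Fin 3} {y y' z : Plane} (hy : InArc c h j y)
    (hy' : InArc c h (j + 1) y') (hz : z ∈ segment ℝ (h j) y)
    (hz' : z ∈ segment ℝ (h (j + 1)) y') : z = y ∧ z = h (j + 1) := by
  have h1 := (hy.of_mem_segment hpos hz).2
  have h2 := (hy'.of_mem_segment hpos hz').1
  rcases h1 with ⟨h1, h1'⟩ | h1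
  · exact ⟨h1, h1.trans h1'⟩
  · exfalso
    rcases h2 with h2 | h2
    · rw [h2, det_self] at h1; exact lt_irrefl _ h1
    · rw [det_swap] at h2; linarith

/-- Two different sectors out of three are always cyclically adjacent, and adjacent ones lie on
opposite sides of their common ray. -/
lemma InArc.inter_of_ne {c : Plane} {h : Fin 3 → Plane}
    (hpos : ∀ j, 0 < det c (h j) (h (j + 1))) {j l : Fin 3} (hjl : j ≠ l) {y y' z : Plane}
    (hy : InArc c h j y) (hy' : InArc c h l y') (hz : z ∈ segment ℝ (h j) y)
    (hz' : z ∈ segment ℝ (h l) y') : (z = h j ∨ z = y) ∧ (z = h l ∨ z = y') := by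
  have : l = j + 1 ∨ j = l + 1 := by
    revert hjl; clear * -; revert j l; decide
  rcases this with rfl | rfl
  · have := hy.inter_succ hpos hy' hz hz'
    exact ⟨Or.inr this.1, Or.inl this.2⟩
  · have := hy'.inter_succ hpos hy hz' hz
    exact ⟨Or.inl this.2, Or.inr this.1⟩

/-- A linear functional separating two families of points. -/
lemma det_pos_of_separated {cA cB p q u : Plane} {m : ℝ}
    (hcA : u 0 * cA 0 + u 1 * cA 1 < m) (hp : u 0 * p 0 + u 1 * p 1 < m)
    (hcB : m < u 0 * cB 0 + u 1 * cB 1) (hq : m < u 0 * q 0 + u 1 * q 1)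
    (hpA : 0 ≤ det cA cB p) (hqA : 0 ≤ det cA cB q) (hpq : 0 < det cA p q)
    (hne : det cB q p ≠ 0) : 0 < det cB q p := by
  by_contra hcon
  have hlt : 0 < det cB p q := by
    rw [det_swap]
    rcases lt_or_gt_of_ne hne with h | h
    · linarith
    · exact absurd h hcon
  -- The affine function u·x − m is applied to the affine dependence of the four points `cA`, `cB`,
  -- `p`, `q`. With the assumed signs the left side is negative and the right side positive.
  have key : det cB p q * (u 0 * cA 0 + u 1 * cA 1 - m) + det cA cB q * (u 0 * p 0 + u 1 * p 1 - m)
      = det cA p q * (u 0 * cB 0 + u 1 * cB 1 - m) + det cA cB p * (u 0 * q 0 + u 1 * q 1 - m) := by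
    unfold det; ring
  have h1 := mul_neg_of_pos_of_neg hlt (sub_neg.2 hcA)
  have h2 := mul_nonpos_of_nonneg_of_nonpos hqA (sub_neg.2 hp).le
  have h3 := mul_pos hpq (sub_pos.2 hcB)
  have h4 := mul_nonneg hpA (sub_pos.2 hq).le
  linarith

lemma inArc_of_above {cA cB p u : Plane} {hB : Fin 3 → Plane} {l : Fin 3} {m : ℝ}
    (hcA : u 0 * cA 0 + u 1 * cA 1 < m) (hp : u 0 * p 0 + u 1 * p 1 < m)
    (hcB : m < u 0 * cB 0 + u 1 * cB 1) (hq : m < u 0 * hB l 0 + u 1 * hB l 1)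
    (hB1 : 0 < det cB (hB l) (hB (l + 1)))
    (hpA : 0 ≤ det cA cB p) (hqA : 0 ≤ det cA cB (hB l))
    (hqn : det cA cB (hB (l + 1)) < 0) (hpq : 0 < det cA p (hB l))
    (hne : det cB (hB l) p ≠ 0) : InArc cB hB l p := by
  have h1 := det_pos_of_separated hcA hp hcB hq hpA hqA hpq hne
  refine ⟨h1, Or.inr ?_⟩
  have pl := det_mul_add cB (hB l) p cA (hB (l + 1))
  have e1 : det cB cA (hB (l + 1)) = - det cA cB (hB (l + 1)) := by unfold det; ring
  have e2 : det cB (hB l) cA = det cA cB (hB l) := by unfold det; ring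
  have e3 : det cB p cA = det cA cB p := by unfold det; ring
  have e4 : det cB (hB (l + 1)) p = - det cB p (hB (l + 1)) := det_swap _ _ _
  rw [e1, e2, e3, e4] at pl
  have m1 := mul_pos h1 (neg_pos.2 hqn)
  have m2 := mul_nonneg hB1.le hpA
  by_contra hcon
  push Not at hcon
  have m3 := mul_nonneg hqA (neg_nonneg.2 hcon)
  linarith

/-- Two triangles around their centres, on different sides of a line, have a pair of vertices each
of which lies in the sector of the other. -/
lemma exists_mutual_inArc {cA cB u : Plane} {hA hB : Fin 3 → Plane} {m : ℝ}
    (hcA : u 0 * cA 0 + u 1 * cA 1 < m) (hp : ∀ j, u 0 * hA j 0 + u 1 * hA j 1 < m)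
    (hcB : m < u 0 * cB 0 + u 1 * cB 1) (hq : ∀ l, m < u 0 * hB l 0 + u 1 * hB l 1)
    (posA : ∀ j, 0 < det cA (hA j) (hA (j + 1))) (posB : ∀ l, 0 < det cB (hB l) (hB (l + 1)))
    (genA : ∀ j l, det cA (hA j) (hB l) ≠ 0) (genB : ∀ j l, det cB (hB l) (hA j) ≠ 0) :
    ∃ j l, InArc cA hA j (hB l) ∧ InArc cB hB l (hA j) := by
  have hneq : ∀ j l, hA j ≠ hB l := by
    intro j l e
    have h1 := hp j
    have h2 := hq l
    rw [e] at h1; linarith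
  have hcne : ∃ l, det cB (hB l) cA ≠ 0 := by
    by_contra! H
    have e0 := H 0
    have e1 := H 1
    have p01 : 0 < det cB (hB 0) (hB 1) := posB 0
    have k0 : det cB (hB 0) (hB 1) * (cA 0 - cB 0) = 0 := by
      have : det cB (hB 0) (hB 1) * (cA 0 - cB 0) = det cB (hB 0) cA * (-(cB 0 - hB 1 0))
        + det cB (hB 1) cA * (cB 0 - hB 0 0) := by unfold det; ring
      rw [this, e0, e1]; ring
    have k1 : det cB (hB 0) (hB 1) * (cA 1 - cB 1) = 0 := by
      have : det cB (hB 0) (hB 1) * (cA 1 - cB 1) = det cB (hB 0) cA * (-(cB 1 - hB 1 1))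
        + det cB (hB 1) cA * (cB 1 - hB 0 1) := by unfold det; ring
      rw [this, e0, e1]; ring
    have : cA = cB := plane_ext
      (by rcases mul_eq_zero.1 k0 with h | h <;> linarith)
      (by rcases mul_eq_zero.1 k1 with h | h <;> linarith)
    rw [this] at hcA; linarith
  -- The sector `l` at `cB` faces `cA`: along it the triangle passes from above the line `cA cB` (or
  -- on it) to below. The sector `j` at `cA` contains `hB l`; the pair `(j, l)` works at once if `hA
  -- j` is not below that line.
  obtain ⟨l, hl0, hl1⟩ := exists_sign_change posB cA hcne
  have e2 : ∀ x, det cB x cA = det cA cB x := fun x => by unfold det; ring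
  rw [e2] at hl0 hl1
  obtain ⟨j, hj⟩ := exists_inArc posA (y := hB l) fun j _ => genA j l
  by_cases hpA : 0 ≤ det cA cB (hA j)
  · exact ⟨j, l, hj, inArc_of_above hcA (hp j) hcB (hq l) (posB l) hpA hl0 hl1 hj.1 (genB j l)⟩
  · push Not at hpA
    have hj2 : 0 < det cA (hB l) (hA (j + 1)) := hj.2.resolve_left (hneq _ _).symm
    have hj3 : 0 < det cA cB (hA (j + 1)) := by
      have pl := det_mul_add cA (hA j) (hB l) cB (hA (j + 1))
      have e1 : det cA (hA j) cB = - det cA cB (hA j) := det_swap _ _ _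
      have e3 : det cA (hA (j + 1)) (hB l) = - det cA (hB l) (hA (j + 1)) := det_swap _ _ _
      have e4 : det cA (hB l) cB = - det cA cB (hB l) := det_swap _ _ _
      rw [e1, e3, e4] at pl
      have m1 := mul_pos (neg_pos.2 hpA) hj2
      have m2 := mul_nonneg (posA j).le hl0
      by_contra hcon
      push Not at hcon
      have m3 := mul_nonneg hj.1.le (neg_nonneg.2 hcon)
      linarith
    obtain ⟨l', hl'⟩ := exists_inArc posB (y := hA j) fun l _ => genB j l
    have e5 : ∀ x, det cB cA x = - det cA cB x := fun x => by unfold det; ring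
    -- Now `hA j` is below and `hA (j + 1)` above. If the hub `hB l'` whose sector contains `hA j`
    -- is not above, a half turn exchanges the two triangles and reduces to `inArc_of_above`.
    -- Otherwise sector `l'` also passes from above to below, which happens only once, so `l' = l`.
    by_cases hqB : det cA cB (hB l') ≤ 0
    · refine ⟨j, l', ?_, hl'⟩
      refine inArc_of_above (cA := cB) (cB := cA) (u := -u) (m := -m) (hB := hA) (l := j)
        (p := hB l') ?_ ?_ ?_ ?_ (posA j) ?_ ?_ ?_ hl'.1 (genA j l')
      · simp only [PiLp.neg_apply]; linarith
      · have := hq l'; simp only [PiLp.neg_apply]; linarith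
      · simp only [PiLp.neg_apply]; linarith
      · have := hp j; simp only [PiLp.neg_apply]; linarith
      · rw [e5]; linarith
      · rw [e5]; linarith
      · rw [e5]; linarith
    · push Not at hqB
      have hl2 : 0 < det cB (hA j) (hB (l' + 1)) := hl'.2.resolve_left (hneq _ _)
      have hl3 : det cA cB (hB (l' + 1)) < 0 := by
        have pl := det_mul_add cB (hB l') (hA j) cA (hB (l' + 1))
        have f1 : det cB (hB l') cA = det cA cB (hB l') := e2 _
        have f2 : det cB cA (hB (l' + 1)) = - det cA cB (hB (l' + 1)) := e5 _
        have f3 : det cB (hA j) cA = det cA cB (hA j) := e2 _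
        have f4 : det cB (hB (l' + 1)) (hA j) = - det cB (hA j) (hB (l' + 1)) := det_swap _ _ _
        rw [f1, f2, f3, f4] at pl
        have m1 := mul_pos hqB hl2
        have m2 := mul_neg_of_pos_of_neg (posB l') hpA
        by_contra hcon
        push Not at hcon
        have m3 := mul_nonneg hl'.1.le hcon
        linarith
      have hll : l' = l := by
        have : l' = l ∨ l' = l + 1 ∨ l = l' + 1 := by clear * -; revert l l'; decide
        rcases this with h | h | h
        · exact h
        · rw [h] at hqB; linarith
        · rw [h] at hl0; linarith
      subst hll
      exact ⟨j, l', hj, hl'⟩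

/-! ### Segments and Voronoi cells. -/

lemma dist_sq_coord (x y : Plane) : dist x y ^ 2 = (x 0 - y 0) ^ 2 + (x 1 - y 1) ^ 2 := by
  rw [EuclideanSpace.dist_sq_eq]
  simp [Fin.sum_univ_two, Real.dist_eq]

/-- Along a segment that starts strictly closer to `a` than to `d` and ends not closer to `d`, only
the end point can fail to be strictly closer to `a`. -/
lemma dist_lt_of_mem_segment {a d h y z : Plane} (hh : dist h a < dist h d)
    (hy : dist y a ≤ dist y d) (hz : z ∈ segment ℝ h y) : z = y ∨ dist z a < dist z d := by
  obtain ⟨s, hs0, hs1, e0, e1⟩ := mem_segment_coord hz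
  rcases hs1.eq_or_lt with rfl | hs
  · left; exact plane_ext (by rw [e0]; ring) (by rw [e1]; ring)
  · right
    have h1 : dist h a ^ 2 < dist h d ^ 2 := by gcongr
    have h2 : dist y a ^ 2 ≤ dist y d ^ 2 := by gcongr
    rw [dist_sq_coord, dist_sq_coord] at h1 h2
    -- The difference of the squared distances to two fixed points is affine along the segment.
    refine lt_of_pow_lt_pow_left₀ 2 dist_nonneg ?_
    rw [dist_sq_coord, dist_sq_coord, e0, e1]
    have m1 := mul_pos (sub_pos.2 hs) (sub_pos.2 h1)
    have m2 := mul_nonneg hs0 (sub_nonneg.2 h2)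
    nlinarith [m1, m2]

-- One half of the Voronoi claim, with one site at the origin and the others at `b` and `d`. A point
-- behind the origin has norm at most `r`. Otherwise it is `s • b + f` with `f` orthogonal to `b`,
-- `‖f‖ ≤ r` and 0 < s ≤ 1/2. Then ‖w − d‖² − ‖w‖² is affine in s and positive at s = 0 by
-- separation (`hA`) and at s = 1/2 by the relative neighbourhood condition (`hB`).
open RealInnerProductSpace in
lemma norm_lt_norm_sub_of_thick {V : Type*} [NormedAddCommGroup V] [InnerProductSpace ℝ V]
    {b d e : V} {t r : ℝ} (ht : 0 ≤ t) (he : ‖e‖ ≤ r) (hd : 4 * r < ‖d‖)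
    (hdb : 4 * r < ‖d - b‖) (hb : b ≠ 0) (hrng : ‖b‖ ≤ ‖d‖ ∨ ‖b‖ ≤ ‖d - b‖)
    (hhalf : ⟪t • b + e, b⟫ ≤ ‖b‖ ^ 2 / 2) : ‖t • b + e‖ < ‖t • b + e - d‖ := by
  have hr : 0 ≤ r := (norm_nonneg e).trans he
  have hbpos : 0 < ‖b‖ ^ 2 := by positivity
  set w := t • b + e with hw
  by_cases hneg : ⟪w, b⟫ ≤ 0
  · have h1 : ‖w‖ ^ 2 ≤ ‖e‖ ^ 2 := by
      have e1 : ‖w‖ ^ 2 = t ^ 2 * ‖b‖ ^ 2 + 2 * t * ⟪b, e⟫ + ‖e‖ ^ 2 := by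
        rw [hw, norm_add_sq_real, norm_smul, inner_smul_left]
        simp only [Real.norm_eq_abs, mul_pow, sq_abs, conj_trivial]
        ring
      have e2 : ⟪w, b⟫ = t * ‖b‖ ^ 2 + ⟪b, e⟫ := by
        rw [hw, inner_add_left, inner_smul_left, real_inner_self_eq_norm_sq, real_inner_comm b e]
        simp
      rw [e2] at hneg
      have h3 := mul_nonneg ht hbpos.le
      have h4 : ⟪b, e⟫ ≤ 0 := by linarith
      have h5 := mul_nonneg ht (neg_nonneg.2 hneg)
      have h6 := mul_nonneg ht (neg_nonneg.2 h4)
      rw [e1]; nlinarith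
    have h2 : ‖w‖ ≤ r := (le_of_sq_le_sq h1 (norm_nonneg e)).trans he
    have h3 : ‖d‖ ≤ ‖w‖ + ‖w - d‖ := by
      have := norm_sub_le w (w - d)
      rwa [sub_sub_cancel] at this
    by_contra hcon
    push Not at hcon
    linarith [norm_nonneg w]
  · push Not at hneg
    set s := ⟪w, b⟫ / ‖b‖ ^ 2 with hs
    have hs0 : 0 < s := div_pos hneg hbpos
    have hs1 : s ≤ 1 / 2 := by rw [hs, div_le_iff₀ hbpos]; linarith
    set f := w - s • b with hf
    have hfb : ⟪f, b⟫ = 0 := by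
      rw [hf, inner_sub_left, inner_smul_left, real_inner_self_eq_norm_sq]
      simp only [conj_trivial, hs]
      field_simp; ring
    have hwf : w = s • b + f := by rw [hf]; abel
    have hfe : ‖f‖ ≤ r := by
      have : e = (s - t) • b + f := by
        rw [hf, hw, sub_smul]; abel
      have h1 : ‖e‖ ^ 2 = (s - t) ^ 2 * ‖b‖ ^ 2 + ‖f‖ ^ 2 := by
        rw [this, norm_add_sq_real, inner_smul_left, real_inner_comm, hfb, norm_smul]
        simp [mul_pow]
      have h2 : ‖f‖ ^ 2 ≤ ‖e‖ ^ 2 := by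
        have := mul_nonneg (sq_nonneg (s - t)) hbpos.le
        linarith
      exact (le_of_sq_le_sq h2 (norm_nonneg e)).trans he
    have hfd : ⟪f, d⟫ ≤ r * ‖d‖ :=
      (real_inner_le_norm f d).trans (mul_le_mul_of_nonneg_right hfe (norm_nonneg d))
    have hfdb : ⟪f, d - b⟫ ≤ r * ‖d - b‖ :=
      (real_inner_le_norm _ _).trans (mul_le_mul_of_nonneg_right hfe (norm_nonneg _))
    have hA : 0 < ‖d‖ ^ 2 - 2 * ⟪f, d⟫ := by nlinarith
    have hfd' : ⟪f, d - b⟫ = ⟪f, d⟫ := by rw [inner_sub_right, hfb, sub_zero]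
    have hdb2 : ‖d - b‖ ^ 2 = ‖d‖ ^ 2 - 2 * ⟪b, d⟫ + ‖b‖ ^ 2 := by
      rw [norm_sub_sq_real, real_inner_comm]
    have hB : 0 < ‖d‖ ^ 2 - ⟪b, d⟫ - 2 * ⟪f, d⟫ := by
      rcases hrng with h | h
      · have h2 : ‖b‖ ^ 2 ≤ ‖d‖ ^ 2 := by gcongr
        rw [hfd'] at hfdb
        nlinarith
      · have h2 : ‖b‖ ^ 2 ≤ ‖d - b‖ ^ 2 := by gcongr
        nlinarith
    have hwd : ⟪w, d⟫ = s * ⟪b, d⟫ + ⟪f, d⟫ := by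
      rw [hwf, inner_add_left, inner_smul_left]; simp
    refine lt_of_pow_lt_pow_left₀ 2 (norm_nonneg _) ?_
    rw [norm_sub_sq_real, hwd]
    have m1 := mul_nonneg (by linarith : 0 ≤ 1 - 2 * s) hA.le
    have m2 := mul_pos hs0 hB
    nlinarith

/-- A segment joining the `r`-neighbourhoods of two neighbours `a`, `b` in the relative neighbourhood
graph of a `4r`-separated set stays in the union of the Voronoi cells of `a` and `b`. -/
lemma dist_lt_of_mem_thick_segment {a b d p q z : Plane} {r : ℝ} (hp : dist p a ≤ r)
    (hq : dist q b ≤ r) (hab : a ≠ b) (had : 4 * r < dist a d) (hbd : 4 * r < dist b d)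
    (hrng : dist a b ≤ dist a d ∨ dist a b ≤ dist b d) (hz : z ∈ segment ℝ p q) :
    dist z a < dist z d ∨ dist z b < dist z d := by
  obtain ⟨s, t, hs, ht, hst, rfl⟩ := hz
  have hconv : ‖s • (p - a) + t • (q - b)‖ ≤ r := by
    calc _ ≤ ‖s • (p - a)‖ + ‖t • (q - b)‖ := norm_add_le _ _
      _ = s * dist p a + t * dist q b := by
        rw [norm_smul, norm_smul, Real.norm_of_nonneg hs, Real.norm_of_nonneg ht, dist_eq_norm,
          dist_eq_norm]
      _ ≤ s * r + t * r := by gcongr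
      _ = r := by rw [← add_mul, hst, one_mul]
  have hs' : s = 1 - t := by linarith
  have ea : s • p + t • q - a = t • (b - a) + (s • (p - a) + t • (q - b)) := by
    rw [hs']; module
  have eb : s • p + t • q - b = s • (a - b) + (s • (p - a) + t • (q - b)) := by
    rw [hs']; module
  -- The two projections onto the segment `a b`, measured from either end, add up to its squared
  -- length, so one of them is at most half of it.
  have hsum : inner ℝ (s • p + t • q - a) (b - a) + inner ℝ (s • p + t • q - b) (a - b)
      = ‖b - a‖ ^ 2 := by
    have : inner ℝ (s • p + t • q - b) (a - b) = - inner ℝ (s • p + t • q - b) (b - a) := by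
      rw [← inner_neg_right, neg_sub]
    rw [this, ← sub_eq_add_neg, ← inner_sub_left, ← real_inner_self_eq_norm_sq]
    congr 1; abel
  have hn : ‖a - b‖ = ‖b - a‖ := norm_sub_rev _ _
  rcases le_total (inner ℝ (s • p + t • q - a) (b - a)) (‖b - a‖ ^ 2 / 2) with h | h
  · left
    have := norm_lt_norm_sub_of_thick (b := b - a) (d := d - a)
      (e := s • (p - a) + t • (q - b)) (t := t) (r := r) ht hconv
      (by rwa [← dist_eq_norm, dist_comm]) (by rwa [sub_sub_sub_cancel_right, ← dist_eq_norm, dist_comm])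
      (sub_ne_zero.2 hab.symm)
      (by rwa [sub_sub_sub_cancel_right, ← dist_eq_norm, ← dist_eq_norm, ← dist_eq_norm,
            dist_comm b a, dist_comm d a, dist_comm d b])
      (by rwa [← ea])
    rwa [← ea, sub_sub_sub_cancel_right, ← dist_eq_norm, ← dist_eq_norm] at this
  · right
    have := norm_lt_norm_sub_of_thick (b := a - b) (d := d - b)
      (e := s • (p - a) + t • (q - b)) (t := s) (r := r) hs hconv
      (by rwa [← dist_eq_norm, dist_comm]) (by rwa [sub_sub_sub_cancel_right, ← dist_eq_norm, dist_comm])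
      (sub_ne_zero.2 hab)
      (by rw [sub_sub_sub_cancel_right, ← dist_eq_norm, ← dist_eq_norm, ← dist_eq_norm,
            dist_comm d a, dist_comm d b]; exact hrng.symm)
      (by rw [← eb, hn]; linarith)
    rwa [← eb, sub_sub_sub_cancel_right, ← dist_eq_norm, ← dist_eq_norm] at this

/-- Points of two disjoint discs of equal radius are separated by the bisector of the centres. -/
lemma bisector_lt {a b p : Plane} {r : ℝ} (hp : dist p a ≤ r) (hab : 2 * r < dist a b) :
    (b - a) 0 * p 0 + (b - a) 1 * p 1 <
      ((b 0) ^ 2 + (b 1) ^ 2 - (a 0) ^ 2 - (a 1) ^ 2) / 2 := by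
  have h1 : dist p a < dist p b := by
    have := dist_triangle_left a b p
    linarith
  have h2 : dist p a ^ 2 < dist p b ^ 2 := by gcongr
  rw [dist_sq_coord, dist_sq_coord] at h2
  simp only [PiLp.sub_apply]
  linarith

lemma lt_bisector {a b p : Plane} {r : ℝ} (hp : dist p b ≤ r) (hab : 2 * r < dist a b) :
    ((b 0) ^ 2 + (b 1) ^ 2 - (a 0) ^ 2 - (a 1) ^ 2) / 2 <
      (b - a) 0 * p 0 + (b - a) 1 * p 1 := by
  have h1 : dist p b < dist p a := by
    have := dist_triangle_left a b p
    linarith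
  have h2 : dist p b ^ 2 < dist p a ^ 2 := by gcongr
  rw [dist_sq_coord, dist_sq_coord] at h2
  simp only [PiLp.sub_apply]
  linarith

/-! ### Generic centres, and triangles obtained by sorting angles. -/

lemma exists_mem_det_ne_zero {U : Set Plane} (hU : IsOpen U) (hne : U.Nonempty)
    (Q : Finset (Plane × Plane)) :
    ∃ c ∈ U, ∀ xy ∈ Q, xy.1 ≠ xy.2 → det c xy.1 xy.2 ≠ 0 := by
  classical
  induction Q using Finset.induction_on generalizing U with
  | empty => obtain ⟨c, hc⟩ := hne; exact ⟨c, hc, by simp⟩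
  | insert xy Q _ ih =>
    obtain ⟨x, y⟩ := xy
    by_cases hxy : x = y
    · obtain ⟨c, hc, h⟩ := ih hU hne
      refine ⟨c, hc, fun p hp hp' => ?_⟩
      rcases Finset.mem_insert.1 hp with rfl | hp
      · exact absurd hxy hp'
      · exact h p hp hp'
    have hcont : Continuous fun c : Plane => det c x y := by unfold det; fun_prop
    have hV : IsOpen (U ∩ {c | det c x y ≠ 0}) := hU.inter (isOpen_ne_fun hcont continuous_const)
    have hVne : (U ∩ {c | det c x y ≠ 0}).Nonempty := by
      obtain ⟨c, hc⟩ := hne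
      by_cases h0 : det c x y = 0
      · set n : Plane := !₂[x 1 - y 1, y 0 - x 0] with hn
        have hcn : Continuous fun s : ℝ => c + s • n := by fun_prop
        have hev : ∀ᶠ s in nhds (0 : ℝ), c + s • n ∈ U :=
          hcn.continuousAt.eventually_mem (hU.mem_nhds (by simpa using hc))
        obtain ⟨ε, hε, hball⟩ := Metric.eventually_nhds_iff.1 hev
        have hs := hball (y := ε / 2) (by rw [Real.dist_eq, sub_zero, abs_of_pos] <;> linarith)
        refine ⟨_, hs, ?_⟩
        have hd : det (c + (ε / 2) • n) x y =
            det c x y + ε / 2 * ((x 1 - y 1) ^ 2 + (y 0 - x 0) ^ 2) := by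
          unfold det
          simp only [hn, PiLp.add_apply, PiLp.smul_apply, smul_eq_mul]
          simp
          ring
        have hpos : 0 < (x 1 - y 1) ^ 2 + (y 0 - x 0) ^ 2 := by
          by_contra hcon
          have h1 : (x 1 - y 1) ^ 2 = 0 := by nlinarith [sq_nonneg (x 1 - y 1), sq_nonneg (y 0 - x 0)]
          have h2 : (y 0 - x 0) ^ 2 = 0 := by nlinarith [sq_nonneg (x 1 - y 1), sq_nonneg (y 0 - x 0)]
          exact hxy (plane_ext (by linarith [pow_eq_zero_iff (two_ne_zero) |>.1 h2])
            (by linarith [pow_eq_zero_iff (two_ne_zero) |>.1 h1]))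
        show det (c + (ε / 2) • n) x y ≠ 0
        rw [hd, h0, zero_add]; positivity
      · exact ⟨c, hc, h0⟩
    obtain ⟨c, hc, h⟩ := ih hV hVne
    refine ⟨c, hc.1, fun p hp hp' => ?_⟩
    rcases Finset.mem_insert.1 hp with rfl | hp
    · exact hc.2
    · exact h p hp hp'

lemma interior_convexHull_triangle_nonempty {a b c : Plane} (h : ¬ Collinear ℝ {a, b, c}) :
    (interior (convexHull ℝ ({a, b, c} : Set Plane))).Nonempty := by
  rw [interior_convexHull_nonempty_iff_affineSpan_eq_top]
  have h1 := affineIndependent_iff_not_collinear_set.2 h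
  have h2 := (h1.affineSpan_eq_top_iff_card_eq_finrank_add_one).2 (by simp)
  rwa [Matrix.range_cons, Matrix.range_cons, Matrix.range_cons, Matrix.range_empty,
    Set.union_empty, Set.singleton_union, Set.singleton_union] at h2

/-- A generic point of depth `k` for `3k` points in general position. -/
lemma exists_generic_center {k : ℕ} (hk : 1 ≤ k) {C Q : Finset Plane} (hC : GeneralPosition C)
    (hcard : C.card = 3 * k) (hCQ : C ⊆ Q) :
    ∃ c ∈ convexHull ℝ (C : Set Plane), (∀ x ∈ Q, ∀ y ∈ Q, x ≠ y → det c x y ≠ 0) ∧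
      ∀ x ∈ C, k ≤ (C.filter fun y => 0 < det c x y).card := by
  classical
  set s := C.powersetCard (2 * k + 1) with hs
  set F : Finset Plane → Set Plane := fun A => interior (convexHull ℝ (A : Set Plane)) with hF
  have hmem : ∀ A ∈ s, A ⊆ C ∧ A.card = 2 * k + 1 := fun A hA => Finset.mem_powersetCard.1 hA
  have hinter : (⋂ A ∈ s, F A).Nonempty := by
    -- Each set of 2k+1 points omits k−1 of the 3k, so any three of them share at least three
    -- points; these span a triangle with nonempty interior.
    refine Convex.helly_theorem' (𝕜 := ℝ) (fun A _ => (convex_convexHull ℝ _).interior) ?_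
    intro I hI hIcard
    rw [finrank_euclideanSpace_fin] at hIcard
    have hcompl : (I.biUnion fun A => C \ A).card ≤ I.card * (k - 1) := by
      refine Finset.card_biUnion_le_card_mul _ _ _ fun A hA => ?_
      obtain ⟨h1, h2⟩ := hmem A (hI hA)
      rw [Finset.card_sdiff_of_subset h1, hcard, h2]; omega
    have h3 : 3 ≤ (C \ (I.biUnion fun A => C \ A)).card := by
      have h4 := Finset.le_card_sdiff (I.biUnion fun A => C \ A) C
      have h5 : I.card * (k - 1) ≤ 3 * (k - 1) := Nat.mul_le_mul_right _ hIcard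
      omega
    obtain ⟨G, hG, hG3⟩ := Finset.exists_subset_card_eq h3
    obtain ⟨x, y, z, hxy, hxz, hyz, rfl⟩ := Finset.card_eq_three.1 hG3
    have hsub : ∀ w ∈ ({x, y, z} : Finset Plane), w ∈ C ∧ ∀ A ∈ I, w ∈ A := by
      intro w hw
      have := Finset.mem_sdiff.1 (hG hw)
      refine ⟨this.1, fun A hA => ?_⟩
      by_contra hcon
      exact this.2 (Finset.mem_biUnion.2 ⟨A, hA, Finset.mem_sdiff.2 ⟨this.1, hcon⟩⟩)
    have hncol := hC x (hsub x (by simp)).1 y (hsub y (by simp)).1 z (hsub z (by simp)).1 hxy hyz hxz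
    obtain ⟨w, hw⟩ := interior_convexHull_triangle_nonempty hncol
    refine ⟨w, Set.mem_iInter₂.2 fun A hA => ?_⟩
    refine interior_mono (convexHull_mono ?_) hw
    intro v hv
    exact (hsub v (by simpa using hv)).2 A hA
  have hopen : IsOpen (⋂ A ∈ s, F A) := isOpen_biInter_finset fun A _ => isOpen_interior
  obtain ⟨c, hc, hgen⟩ := exists_mem_det_ne_zero hopen hinter (Q ×ˢ Q)
  have hcF : ∀ A ∈ s, c ∈ F A := fun A hA => Set.mem_iInter₂.1 hc A hA
  have hgen' : ∀ x ∈ Q, ∀ y ∈ Q, x ≠ y → det c x y ≠ 0 :=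
    fun x hx y hy hxy => hgen (x, y) (Finset.mem_product.2 ⟨hx, hy⟩) hxy
  refine ⟨c, ?_, hgen', ?_⟩
  · obtain ⟨A, hA, hA2⟩ := Finset.exists_subset_card_eq (s := C) (n := 2 * k + 1) (by omega)
    exact convexHull_mono (by exact_mod_cast hA)
      (interior_subset (hcF A (Finset.mem_powersetCard.2 ⟨hA, hA2⟩)))
  · intro x hx
    -- With fewer than k points strictly to the left of the line from `c` to `x`, some 2k+1 points
    -- lie in the closed right half-plane. Then `c` is on the boundary of a half-plane containing
    -- their hull, yet interior to that hull.
    by_contra! hlt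
    have h1 := Finset.card_filter_add_card_filter_not (s := C) (fun y => 0 < det c x y)
    obtain ⟨A, hA, hA2⟩ := Finset.exists_subset_card_eq
      (s := C.filter fun y => ¬ 0 < det c x y) (n := 2 * k + 1) (by omega)
    have hcA := hcF A (Finset.mem_powersetCard.2 ⟨hA.trans (Finset.filter_subset _ _), hA2⟩)
    have hxc : x ≠ c := by
      rintro rfl
      obtain ⟨y, hy, hyx⟩ := Finset.exists_mem_ne (s := C) (by omega) x
      exact hgen' x (hCQ hx) y (hCQ hy) hyx.symm (det_left_self x y)
    have hhalf : convexHull ℝ (A : Set Plane) ⊆ {z | det c x z ≤ 0} := by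
      refine convexHull_min (fun z hz => not_lt.1 (Finset.mem_filter.1 (hA hz)).2) ?_
      intro z hz w hw a b ha hb hab
      have : det c x (a • z + b • w) = a * det c x z + b * det c x w := by
        unfold det
        simp only [PiLp.add_apply, PiLp.smul_apply, smul_eq_mul]
        linear_combination (c 1 * (x 0 - c 0) - c 0 * (x 1 - c 1)) * hab
      show det c x (a • z + b • w) ≤ 0
      rw [this]
      have m1 := mul_nonneg ha (neg_nonneg.2 hz)
      have m2 := mul_nonneg hb (neg_nonneg.2 hw)
      linarith
    set n : Plane := !₂[-(x 1 - c 1), x 0 - c 0] with hn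
    have hcn : Continuous fun s : ℝ => c + s • n := by fun_prop
    have hev : ∀ᶠ s in nhds (0 : ℝ), c + s • n ∈ F A :=
      hcn.continuousAt.eventually_mem (isOpen_interior.mem_nhds (by simpa using hcA))
    obtain ⟨ε, hε, hball⟩ := Metric.eventually_nhds_iff.1 hev
    have hs := hball (y := ε / 2) (by rw [Real.dist_eq, sub_zero, abs_of_pos] <;> linarith)
    have hle : det c x (c + (ε / 2) • n) ≤ 0 := hhalf (interior_subset hs)
    have hd : det c x (c + (ε / 2) • n) = ε / 2 * dist x c ^ 2 := by
      rw [dist_sq_coord]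
      unfold det
      simp only [hn, PiLp.add_apply, PiLp.smul_apply, smul_eq_mul]
      simp
      ring
    have := dist_pos.2 hxc
    rw [hd] at hle
    have : 0 < ε / 2 * dist x c ^ 2 := by positivity
    linarith

/-- The direction of `x` seen from `c`. -/
noncomputable def dir (c x : Plane) : ℝ := Complex.arg ⟨x 0 - c 0, x 1 - c 1⟩

lemma det_eq_sin (c x y : Plane) :
    det c x y = ‖(⟨x 0 - c 0, x 1 - c 1⟩ : ℂ)‖ * ‖(⟨y 0 - c 0, y 1 - c 1⟩ : ℂ)‖ *
      Real.sin (dir c y - dir c x) := by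
  have h1 := Complex.norm_mul_cos_arg (⟨x 0 - c 0, x 1 - c 1⟩ : ℂ)
  have h2 := Complex.norm_mul_sin_arg (⟨x 0 - c 0, x 1 - c 1⟩ : ℂ)
  have h3 := Complex.norm_mul_cos_arg (⟨y 0 - c 0, y 1 - c 1⟩ : ℂ)
  have h4 := Complex.norm_mul_sin_arg (⟨y 0 - c 0, y 1 - c 1⟩ : ℂ)
  simp only at h1 h2 h3 h4
  unfold det dir
  rw [Real.sin_sub]
  generalize Complex.arg (⟨x 0 - c 0, x 1 - c 1⟩ : ℂ) = θ at *
  generalize Complex.arg (⟨y 0 - c 0, y 1 - c 1⟩ : ℂ) = φ at *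
  generalize ‖(⟨x 0 - c 0, x 1 - c 1⟩ : ℂ)‖ = m at *
  generalize ‖(⟨y 0 - c 0, y 1 - c 1⟩ : ℂ)‖ = n at *
  rw [← h1, ← h2, ← h3, ← h4]
  ring

/-- Arguments lie in (−π, π], so their difference lies in (−2π, 2π), where the sine is positive
exactly on (0, π) and below −π. -/
lemma det_pos_imp {c x y : Plane} (h : 0 < det c x y) :
    (0 < dir c y - dir c x ∧ dir c y - dir c x < Real.pi) ∨ dir c y - dir c x < -Real.pi := by
  have hx1 := Complex.neg_pi_lt_arg (⟨x 0 - c 0, x 1 - c 1⟩ : ℂ)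
  have hx2 := Complex.arg_le_pi (⟨x 0 - c 0, x 1 - c 1⟩ : ℂ)
  have hy1 := Complex.neg_pi_lt_arg (⟨y 0 - c 0, y 1 - c 1⟩ : ℂ)
  have hy2 := Complex.arg_le_pi (⟨y 0 - c 0, y 1 - c 1⟩ : ℂ)
  change -Real.pi < dir c x at hx1
  change dir c x ≤ Real.pi at hx2
  change -Real.pi < dir c y at hy1
  change dir c y ≤ Real.pi at hy2
  rw [det_eq_sin] at h
  have hsin : 0 < Real.sin (dir c y - dir c x) := by
    by_contra hcon
    have := mul_nonpos_of_nonneg_of_nonpos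
      (mul_nonneg (norm_nonneg (⟨x 0 - c 0, x 1 - c 1⟩ : ℂ))
        (norm_nonneg (⟨y 0 - c 0, y 1 - c 1⟩ : ℂ))) (not_lt.1 hcon)
    linarith
  by_contra! hcon
  rcases le_or_gt (dir c y - dir c x) 0 with h0 | h0
  · have := Real.sin_nonpos_of_nonpos_of_neg_pi_le h0 hcon.2
    linarith
  · have h1 := hcon.1 h0
    have h2 : Real.sin (dir c y - dir c x - 2 * Real.pi) ≤ 0 :=
      Real.sin_nonpos_of_nonpos_of_neg_pi_le (by linarith) (by linarith)
    rw [Real.sin_sub_two_pi] at h2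
    linarith

lemma det_pos_of {c x y : Plane} (hx : x ≠ c) (hy : y ≠ c)
    (h : (0 < dir c y - dir c x ∧ dir c y - dir c x < Real.pi) ∨ dir c y - dir c x < -Real.pi) :
    0 < det c x y := by
  have hnorm : ∀ z : Plane, z ≠ c → 0 < ‖(⟨z 0 - c 0, z 1 - c 1⟩ : ℂ)‖ := by
    intro z hz
    rw [norm_pos_iff]
    intro h0
    have h1 := congrArg Complex.re h0
    have h2 := congrArg Complex.im h0
    simp only [Complex.zero_re, Complex.zero_im] at h1 h2
    exact hz (plane_ext (by linarith) (by linarith))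
  rw [det_eq_sin]
  refine mul_pos (mul_pos (hnorm x hx) (hnorm y hy)) ?_
  rcases h with ⟨h1, h2⟩ | h1
  · exact Real.sin_pos_of_pos_of_lt_pi h1 h2
  · have hx2 := Complex.arg_le_pi (⟨x 0 - c 0, x 1 - c 1⟩ : ℂ)
    have hy1 := Complex.neg_pi_lt_arg (⟨y 0 - c 0, y 1 - c 1⟩ : ℂ)
    change dir c x ≤ Real.pi at hx2
    change -Real.pi < dir c y at hy1
    rw [← Real.sin_add_two_pi]
    exact Real.sin_pos_of_pos_of_lt_pi (by linarith) (by linarith)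

/-- A centre `c` in the hull of `C`, in general position with respect to `Q`, and `k` disjoint
counterclockwise triangles around it with vertices in `C`. -/
structure IsFan (k : ℕ) (C Q : Finset Plane) (c : Plane) (h : Fin k → Fin 3 → Plane) : Prop where
  center_mem : c ∈ convexHull ℝ (C : Set Plane)
  hub_mem : ∀ i j, h i j ∈ C
  hub_inj : ∀ i j i' j', h i j = h i' j' → i = i' ∧ j = j'
  det_pos : ∀ i j, 0 < det c (h i j) (h i (j + 1))
  generic : ∀ x ∈ Q, ∀ y ∈ Q, x ≠ y → det c x y ≠ 0

/-- With the 3k points sorted by angle about `c`, the points with indices i, i+k, i+2k form the i-th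
triangle. Depth `k` of the centre makes each step of k places a turn by less than π. -/
lemma exists_isFan {k : ℕ} (hk : 1 ≤ k) {C Q : Finset Plane} (hC : GeneralPosition C)
    (hcard : 3 * k ≤ C.card) (hCQ : C ⊆ Q) : ∃ c h, IsFan k C Q c h := by
  classical
  obtain ⟨C', hC', hcard'⟩ := Finset.exists_subset_card_eq hcard
  obtain ⟨c, hc, hgen, hdepth⟩ := exists_generic_center hk (C := C') (Q := Q)
    (fun a ha b hb d hd => hC a (hC' ha) b (hC' hb) d (hC' hd)) hcard' (hC'.trans hCQ)
  have hne : ∀ x ∈ C', x ≠ c := by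
    rintro x hx rfl
    obtain ⟨y, hy, hyx⟩ := Finset.exists_mem_ne (s := C') (by omega) x
    exact hgen x (hCQ (hC' hx)) y (hCQ (hC' hy)) hyx.symm (det_left_self x y)
  have hinj : Set.InjOn (dir c) C' := by
    intro x hx y hy hxy
    by_contra hcon
    refine hgen x (hCQ (hC' hx)) y (hCQ (hC' hy)) hcon ?_
    rw [det_eq_sin, hxy, sub_self, Real.sin_zero, mul_zero]
  have himg : (C'.image (dir c)).card = 3 * k := by
    rw [Finset.card_image_of_injOn hinj, hcard']
  set e := (C'.image (dir c)).orderEmbOfFin himg with he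
  have hX : ∀ n, ∃ x ∈ C', dir c x = e n := fun n =>
    Finset.mem_image.1 (Finset.orderEmbOfFin_mem _ himg n)
  choose X hXC hXe using hX
  have hsurj : ∀ y ∈ C', ∃ n, X n = y := by
    intro y hy
    have : dir c y ∈ Set.range e := by
      rw [he, Finset.range_orderEmbOfFin]
      exact Finset.mem_coe.2 (Finset.mem_image_of_mem _ hy)
    obtain ⟨n, hn⟩ := this
    exact ⟨n, hinj (hXC n) hy ((hXe n).trans hn)⟩
  have hXinj : Function.Injective X := by
    intro m n hmn
    apply e.injective
    rw [← hXe, ← hXe, hmn]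
  have hcount : ∀ (n : Fin (3 * k)) (J : Finset (Fin (3 * k))),
      (∀ m, 0 < det c (X n) (X m) → m ∈ J) → k ≤ J.card := by
    intro n J hJ
    refine (hdepth _ (hXC n)).trans ((Finset.card_le_card ?_).trans
      (Finset.card_image_le (s := J) (f := X)))
    intro y hy
    obtain ⟨hy1, hy2⟩ := Finset.mem_filter.1 hy
    obtain ⟨m, rfl⟩ := hsurj y hy1
    exact Finset.mem_image_of_mem _ (hJ m hy2)
  have hlow : ∀ n, -Real.pi < e n := fun n => by rw [← hXe]; exact Complex.neg_pi_lt_arg _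
  have hup : ∀ n, e n ≤ Real.pi := fun n => by rw [← hXe]; exact Complex.arg_le_pi _
  have step : ∀ n m : Fin (3 * k), (m : ℕ) = n + k → 0 < det c (X n) (X m) := by
    intro n m hm
    by_contra hcon
    have hnm : n < m := by rw [Fin.lt_def]; omega
    have hlt : e n < e m := e.strictMono hnm
    -- If the turn were at least π, every point to the left of `X n` would have its index strictly
    -- between n and n+k, which allows only k−1.
    have hpi : Real.pi ≤ e m - e n := by
      by_contra h2
      exact hcon (det_pos_of (hne _ (hXC n)) (hne _ (hXC m))
        (Or.inl (by rw [hXe, hXe]; constructor <;> linarith)))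
    have := hcount n (Finset.Ioo n m) fun l hl => by
      rcases det_pos_imp hl with ⟨h1, h2⟩ | h1
      · rw [hXe, hXe] at h1 h2
        exact Finset.mem_Ioo.2 ⟨e.lt_iff_lt.1 (by linarith), e.lt_iff_lt.1 (by linarith)⟩
      · rw [hXe, hXe] at h1
        linarith [hlow l, hup m, hlow n]
    rw [Fin.card_Ioo] at this
    omega
  have wrap : ∀ n m : Fin (3 * k), (m : ℕ) = n + 2 * k → 0 < det c (X m) (X n) := by
    intro n m hm
    by_contra hcon
    have hpi : -Real.pi ≤ e n - e m := by
      by_contra h2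
      exact hcon (det_pos_of (hne _ (hXC m)) (hne _ (hXC n))
        (Or.inr (by rw [hXe, hXe]; linarith)))
    -- The same count across the branch cut of the argument: k−1 indices are above m = n+2k or below
    -- n.
    have := hcount m (Finset.Ioi m ∪ Finset.Iio n) fun l hl => by
      rcases det_pos_imp hl with ⟨h1, h2⟩ | h1
      · rw [hXe, hXe] at h1
        exact Finset.mem_union_left _ (Finset.mem_Ioi.2 (e.lt_iff_lt.1 (by linarith)))
      · rw [hXe, hXe] at h1
        exact Finset.mem_union_right _ (Finset.mem_Iio.2 (e.lt_iff_lt.1 (by linarith)))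
    have h2 := Finset.card_union_le (Finset.Ioi m) (Finset.Iio n)
    rw [Fin.card_Ioi, Fin.card_Iio] at h2
    omega
  have hidx : ∀ (i : Fin k) (j : Fin 3), (i : ℕ) + j * k < 3 * k := by
    intro i j
    have h1 := i.2
    have h2 : (j : ℕ) * k ≤ 2 * k := Nat.mul_le_mul_right _ (by omega)
    omega
  refine ⟨c, fun i j => X ⟨i + j * k, hidx i j⟩, ?_, ?_, ?_, ?_, hgen⟩
  · exact convexHull_mono (by exact_mod_cast hC') hc
  · exact fun i j => hC' (hXC _)
  · intro i j i' j' h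
    have h1 := congrArg Fin.val (hXinj h)
    simp only at h1
    have hi := i.2
    have hi' := i'.2
    have h2 : ((i : ℕ) + j * k) % k = i := by rw [Nat.add_mul_mod_self_right, Nat.mod_eq_of_lt hi]
    have h3 : ((i' : ℕ) + j' * k) % k = i' := by
      rw [Nat.add_mul_mod_self_right, Nat.mod_eq_of_lt hi']
    have h4 : (i : ℕ) = i' := by rw [← h2, h1, h3]
    refine ⟨Fin.ext h4, Fin.ext ?_⟩
    have h5 : (j : ℕ) * k = j' * k := by omega
    exact Nat.eq_of_mul_eq_mul_right (by omega) h5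
  · intro i j
    fin_cases j
    · exact step _ _ (by simp)
    · exact step _ _ (by simp; ring)
    · exact wrap _ _ (by simp)

/-! ### Definition of sites, Voronoi owners, spokes and bridges. -/

/-- `v` is a point of `S` with at least `3k` points of `S` within distance `3t/2`. -/
def Dense (k : ℕ) (t : ℝ) (S : Finset Plane) (v : Plane) : Prop :=
  v ∈ S ∧ 3 * k ≤ (localView S v (3 / 2 * t)).card

/-- The cell of `v` in the square grid of side `4t`. -/
noncomputable def cell (t : ℝ) (v : Plane) : ℤ × ℤ := (⌊v 0 / (4 * t)⌋, ⌊v 1 / (4 * t)⌋)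

/-- The colour of the cell of `v`, in a periodic colouring of the grid with nine colours. -/
noncomputable def colour (t : ℝ) (v : Plane) : ℕ :=
  ((cell t v).1 % 3 * 3 + (cell t v).2 % 3).toNat

/-- The dense points in the cell of `v` that are far from the points of `A`. -/
def candidates (k : ℕ) (t : ℝ) (S : Finset Plane) (A : Set Plane) (v : Plane) : Set Plane :=
  {w | Dense k t S w ∧ cell t w = cell t v ∧ ∀ d ∈ A, 6 * t < dist w d}

/-- A net of dense points, built one colour class at a time. -/
def net (k : ℕ) (t : ℝ) (S : Finset Plane) : ℕ → Set Plane
  | 0 => ∅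
  | n + 1 => net k t S n ∪ {v | colour t v = n ∧ v ∈ candidates k t S (net k t S n) v ∧
      v = Classical.epsilon (· ∈ candidates k t S (net k t S n) v)}

/-- The sites: the net obtained once all nine colours have been treated. -/
def Site (k : ℕ) (t : ℝ) (S : Finset Plane) (a : Plane) : Prop := a ∈ net k t S 9

/-- `a` is a site nearest to `y`. -/
def Nearest (k : ℕ) (t : ℝ) (S : Finset Plane) (y a : Plane) : Prop :=
  Site k t S a ∧ dist y a ≤ 9 * t ∧ ∀ d, Site k t S d → dist y a ≤ dist y d

/-- `a` is the nearest site to which `y` is assigned. -/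
def Owns (k : ℕ) (t : ℝ) (S : Finset Plane) (a y : Plane) : Prop :=
  Nearest k t S y a ∧ a = Classical.epsilon (Nearest k t S y)

/-- `a` and `b` are neighbours in the relative neighbourhood graph of the sites. -/
def SiteAdj (k : ℕ) (t : ℝ) (S : Finset Plane) (a b : Plane) : Prop :=
  Site k t S a ∧ Site k t S b ∧ a ≠ b ∧ dist a b ≤ 27 / 2 * t ∧
    ∀ d, Site k t S d → dist a b ≤ dist a d ∨ dist a b ≤ dist b d

/-- The centre and the hubs chosen at the site `a`. -/
noncomputable def fan (k : ℕ) (t : ℝ) (S : Finset Plane) (a : Plane) :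
    Plane × (Fin k → Fin 3 → Plane) :=
  Classical.epsilon fun f =>
    IsFan k (localView S a (3 / 2 * t)) (localView S a (20 * t)) f.1 f.2

/-- `x` is the `j`-th hub of layer `i` at the site `a`, and `y` lies in its sector. -/
def InSector (k : ℕ) (t : ℝ) (S : Finset Plane) (i : Fin k) (a : Plane) (j : Fin 3)
    (x y : Plane) : Prop :=
  x = (fan k t S a).2 i j ∧ dist x a ≤ 3 / 2 * t ∧ InArc (fan k t S a).1 ((fan k t S a).2 i) j y

/-- `y` is assigned to the site `a` and joined to the hub `x` of `a` whose sector contains it. -/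
def Spoke (k : ℕ) (t : ℝ) (S : Finset Plane) (i : Fin k) (a x y : Plane) : Prop :=
  y ∈ S ∧ Owns k t S a y ∧ ∃ j, InSector k t S i a j x y

/-- `x` and `y` are hubs of the neighbouring sites `a` and `b`, each in the sector of the other. -/
def Bridge (k : ℕ) (t : ℝ) (S : Finset Plane) (i : Fin k) (a b x y : Plane) : Prop :=
  SiteAdj k t S a b ∧ (∃ j, InSector k t S i a j x y) ∧ ∃ l, InSector k t S i b l y x

/-- The edges of layer `i`. -/
def Edge (k : ℕ) (t : ℝ) (S : Finset Plane) (i : Fin k) (x y : Plane) : Prop :=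
  (∃ a, Spoke k t S i a x y ∨ Spoke k t S i a y x) ∨ ∃ a b, Bridge k t S i a b x y

/-! ### Separation and covering by the net. -/

section Net

variable {k : ℕ} {t : ℝ} {S : Finset Plane}

lemma dist_le_of_cell_eq (ht : 0 < t) {v w : Plane} (h : cell t v = cell t w) :
    dist v w ≤ 6 * t := by
  have key : ∀ x y : ℝ, ⌊x / (4 * t)⌋ = ⌊y / (4 * t)⌋ → (x - y) ^ 2 ≤ (4 * t) ^ 2 := by
    intro x y hxy
    have h1 := Int.abs_sub_lt_one_of_floor_eq_floor hxy
    rw [← sub_div, abs_div, abs_of_pos (by linarith : 0 < 4 * t), div_lt_one (by linarith)] at h1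
    exact sq_le_sq' (by linarith [neg_abs_le (x - y)]) (by linarith [le_abs_self (x - y)])
  have h0 := key _ _ (congrArg Prod.fst h)
  have h1 := key _ _ (congrArg Prod.snd h)
  refine abs_le_of_sq_le_sq' ?_ (by linarith) |>.2
  rw [dist_sq_coord]
  nlinarith

/-- Distinct cells of one colour differ by at least 3 in some coordinate, so two full cells of side
`4t` lie between them. This lets all cells of a colour be treated simultaneously. -/
lemma lt_dist_of_colour_eq (ht : 0 < t) {v w : Plane} (hc : colour t v = colour t w)
    (h : cell t v ≠ cell t w) : 6 * t < dist v w := by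
  have hfl : ∀ x y : ℝ, ⌊x / (4 * t)⌋ + 3 ≤ ⌊y / (4 * t)⌋ → 8 * t ≤ y - x := by
    intro x y hxy
    have h1 := Int.lt_floor_add_one (x / (4 * t))
    have h2 := Int.floor_le (y / (4 * t))
    have h3 : (⌊x / (4 * t)⌋ : ℝ) + 3 ≤ ⌊y / (4 * t)⌋ := by exact_mod_cast hxy
    have h4 : 2 ≤ y / (4 * t) - x / (4 * t) := by linarith
    rw [← sub_div, le_div_iff₀ (by linarith)] at h4
    linarith
  have key : ∀ x y : ℝ, ⌊x / (4 * t)⌋ % 3 = ⌊y / (4 * t)⌋ % 3 → ⌊x / (4 * t)⌋ ≠ ⌊y / (4 * t)⌋ →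
      (8 * t) ^ 2 ≤ (x - y) ^ 2 := by
    intro x y hm hne
    have : ⌊x / (4 * t)⌋ + 3 ≤ ⌊y / (4 * t)⌋ ∨ ⌊y / (4 * t)⌋ + 3 ≤ ⌊x / (4 * t)⌋ := by omega
    rcases this with h | h
    · have := hfl _ _ h; nlinarith
    · have := hfl _ _ h; nlinarith
  have hmod : (cell t v).1 % 3 = (cell t w).1 % 3 ∧ (cell t v).2 % 3 = (cell t w).2 % 3 := by
    unfold colour at hc; omega
  have hsq : (8 * t) ^ 2 ≤ dist v w ^ 2 := by
    rw [dist_sq_coord]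
    by_cases h0 : (cell t v).1 = (cell t w).1
    · have h1 : (cell t v).2 ≠ (cell t w).2 := fun h1 => h (Prod.ext h0 h1)
      have := key _ _ hmod.2 h1
      nlinarith [sq_nonneg (v 0 - w 0)]
    · have := key _ _ hmod.1 h0
      nlinarith [sq_nonneg (v 1 - w 1)]
  have := abs_le_of_sq_le_sq' hsq dist_nonneg |>.2
  linarith

lemma candidates_congr {A : Set Plane} {v w : Plane} (h : cell t v = cell t w) :
    candidates k t S A v = candidates k t S A w := by
  unfold candidates; rw [h]

lemma net_mono {m n : ℕ} (h : m ≤ n) : net k t S m ⊆ net k t S n := by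
  induction n, h using Nat.le_induction with
  | base => exact subset_rfl
  | succ n _ ih => exact ih.trans Set.subset_union_left

lemma dense_of_mem_net {n : ℕ} {v : Plane} (h : v ∈ net k t S n) : Dense k t S v := by
  induction n with
  | zero => exact h.elim
  | succ n ih =>
    rcases h with h | h
    · exact ih h
    · exact h.2.1.1

lemma lt_dist_of_mem_net (ht : 0 < t) {n : ℕ} {v w : Plane} (hv : v ∈ net k t S n)
    (hw : w ∈ net k t S n) (hne : v ≠ w) : 6 * t < dist v w := by
  induction n with
  | zero => exact hv.elim
  | succ n ih =>
    rcases hv with hv | hv <;> rcases hw with hw | hw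
    · exact ih hv hw
    · rw [dist_comm]; exact hw.2.1.2.2 v hv
    · exact hv.2.1.2.2 w hw
    · by_cases hc : cell t v = cell t w
      · refine absurd ?_ hne
        rw [hv.2.2, hw.2.2, candidates_congr hc]
      · exact lt_dist_of_colour_eq ht (hv.1.trans hw.1.symm) hc

lemma colour_lt (v : Plane) : colour t v < 9 := by
  unfold colour; omega

lemma Site.dense {a : Plane} (h : Site k t S a) : Dense k t S a := dense_of_mem_net h

lemma Site.mem {a : Plane} (h : Site k t S a) : a ∈ S := h.dense.1

lemma Site.lt_dist (ht : 0 < t) {a b : Plane} (ha : Site k t S a) (hb : Site k t S b)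
    (hne : a ≠ b) : 6 * t < dist a b := lt_dist_of_mem_net ht ha hb hne

/-- When the colour of `v` is treated, either the net already has a point within `6t`, or `v` is a
candidate and its cell, of diameter below `6t`, receives a site. -/
lemma Dense.exists_site (ht : 0 < t) {v : Plane} (hv : Dense k t S v) :
    ∃ a, Site k t S a ∧ dist v a ≤ 6 * t := by
  have hn := colour_lt (t := t) v
  by_cases h : ∀ d ∈ net k t S (colour t v), 6 * t < dist v d
  · have hne : ∃ w, w ∈ candidates k t S (net k t S (colour t v)) v := ⟨v, hv, rfl, h⟩
    have hw := Classical.epsilon_spec hne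
    set w := Classical.epsilon (· ∈ candidates k t S (net k t S (colour t v)) v) with hwdef
    have hc : cell t w = cell t v := hw.2.1
    have hcol : colour t w = colour t v := by unfold colour; rw [hc]
    refine ⟨w, net_mono (show colour t v + 1 ≤ 9 from hn) (Or.inr ⟨hcol, ?_, ?_⟩),
      dist_le_of_cell_eq ht hc.symm⟩
    · rw [candidates_congr hc]; exact hw
    · rw [candidates_congr hc]
  · push Not at h
    obtain ⟨d, hd, hvd⟩ := h
    exact ⟨d, net_mono hn.le hd, hvd⟩

end Net

/-! ### Locality of the construction. -/

/-- The sets `S` and `S'` agree within distance `R` of `p`. -/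
def Agree (S S' : Finset Plane) (p : Plane) (R : ℝ) : Prop :=
  ∀ z, dist z p ≤ R → (z ∈ S ↔ z ∈ S')

section Locality

variable {k : ℕ} {t : ℝ} {S S' : Finset Plane} {p q : Plane} {R r : ℝ}

lemma Agree.symm (h : Agree S S' p R) : Agree S' S p R := fun z hz => (h z hz).symm

lemma Agree.mono (h : Agree S S' p R) (hq : dist q p + r ≤ R) : Agree S S' q r := by
  intro z hz
  exact h z (by linarith [dist_triangle z q p])

lemma Agree.localView_eq (h : Agree S S' p r) : localView S p r = localView S' p r := by
  ext z
  simp only [localView, Finset.mem_filter]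
  constructor <;> rintro ⟨h1, h2⟩
  · exact ⟨(h z (by rwa [dist_comm])).1 h1, h2⟩
  · exact ⟨(h z (by rwa [dist_comm])).2 h1, h2⟩

lemma agree_localView (p : Plane) (R : ℝ) : Agree S (localView S p R) p R := by
  intro z hz
  simp only [localView, Finset.mem_filter]
  exact ⟨fun h => ⟨h, by rwa [dist_comm]⟩, fun h => h.1⟩

lemma Agree.dense_iff (ht : 0 < t) (h : Agree S S' p (3 / 2 * t)) :
    Dense k t S p ↔ Dense k t S' p := by
  unfold Dense
  rw [h.localView_eq, h p (by rw [dist_self]; linarith)]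

/-- A round inspects the points of one cell and the net points within `6t` of them, so it adds 12t
to the radius `3t/2` needed for density. Nine rounds give 109.5t, rounded up to `110 * t`
afterwards. -/
lemma Agree.mem_net_iff (ht : 0 < t) {n : ℕ} (h : Agree S S' p (3 / 2 * t + 12 * t * n)) :
    p ∈ net k t S n ↔ p ∈ net k t S' n := by
  induction n generalizing p with
  | zero => exact Iff.rfl
  | succ n ih =>
    push_cast at h
    have hn : 0 ≤ 12 * t * n := by positivity
    have hc : candidates k t S (net k t S n) p = candidates k t S' (net k t S' n) p := by
      ext w
      by_cases hw : cell t w = cell t p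
      · have hd := dist_le_of_cell_eq ht hw
        have h1 : Dense k t S w ↔ Dense k t S' w := (h.mono (by linarith)).dense_iff ht
        have h2 : (∀ d ∈ net k t S n, 6 * t < dist w d) ↔
            ∀ d ∈ net k t S' n, 6 * t < dist w d := by
          refine forall_congr' fun d => ?_
          by_cases hwd : 6 * t < dist w d
          · simp [hwd]
          · have : d ∈ net k t S n ↔ d ∈ net k t S' n := ih (h.mono (by
              linarith [dist_triangle_left d p w]))
            rw [this]
        simp only [candidates, Set.mem_ofPred_eq, h1, h2]
      · simp [candidates, hw]
    have h0 : p ∈ net k t S n ↔ p ∈ net k t S' n := ih (h.mono (by rw [dist_self]; linarith))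
    simp only [net, Set.mem_union, Set.mem_ofPred_eq, h0, hc]

lemma Agree.site_iff (ht : 0 < t) (h : Agree S S' p (110 * t)) :
    Site k t S p ↔ Site k t S' p :=
  Agree.mem_net_iff ht (h.mono (by push_cast; rw [dist_self]; linarith))

lemma Agree.nearest_iff (ht : 0 < t) (h : Agree S S' p (119 * t)) :
    Nearest k t S p q ↔ Nearest k t S' p q := by
  unfold Nearest
  by_cases hq : dist p q ≤ 9 * t
  · have h1 : ∀ d, dist p d ≤ 9 * t → (Site k t S d ↔ Site k t S' d) := fun d hd =>
      (h.mono (by rw [dist_comm]; linarith)).site_iff ht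
    have h2 : (∀ d, Site k t S d → dist p q ≤ dist p d) ↔
        ∀ d, Site k t S' d → dist p q ≤ dist p d := by
      refine forall_congr' fun d => ?_
      by_cases hd : dist p q ≤ dist p d
      · simp [hd]
      · rw [h1 d (by linarith)]
    rw [h1 q hq, h2]
  · simp [hq]

lemma Agree.owns_iff (ht : 0 < t) (h : Agree S S' p (119 * t)) :
    Owns k t S q p ↔ Owns k t S' q p := by
  have : Nearest k t S p = Nearest k t S' p := funext fun a => propext (h.nearest_iff ht)
  unfold Owns
  rw [this]

lemma Agree.siteAdj_iff (ht : 0 < t) (h : Agree S S' p (130 * t)) :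
    SiteAdj k t S p q ↔ SiteAdj k t S' p q := by
  unfold SiteAdj
  by_cases hq : dist p q ≤ 27 / 2 * t
  · have h1 : ∀ d, dist p d ≤ 27 / 2 * t → (Site k t S d ↔ Site k t S' d) := fun d hd =>
      (h.mono (by rw [dist_comm]; linarith)).site_iff ht
    have h2 : (∀ d, Site k t S d → dist p q ≤ dist p d ∨ dist p q ≤ dist q d) ↔
        ∀ d, Site k t S' d → dist p q ≤ dist p d ∨ dist p q ≤ dist q d := by
      refine forall_congr' fun d => ?_
      -- Only sites closer to `p` than `q` can violate the condition, so no distant site matters.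
      by_cases hd : dist p q ≤ dist p d
      · simp [hd]
      · rw [h1 d (by linarith)]
    rw [h1 q hq, h1 p (by rw [dist_self]; linarith), h2]
  · simp [hq]

lemma Agree.fan_eq (ht : 0 < t) (h : Agree S S' p (20 * t)) : fan k t S p = fan k t S' p := by
  unfold fan
  rw [h.localView_eq, (h.mono (q := p) (r := 3 / 2 * t) (by rw [dist_self]; linarith)).localView_eq]

lemma Agree.inSector_iff (ht : 0 < t) {i : Fin k} {j : Fin 3} {x y : Plane}
    (h : Agree S S' p (20 * t)) : InSector k t S i p j x y ↔ InSector k t S' i p j x y := by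
  unfold InSector
  rw [h.fan_eq ht]

lemma Spoke.dist_le {i : Fin k} {a x y : Plane} (h : Spoke k t S i a x y) :
    dist a x ≤ 3 / 2 * t ∧ dist y a ≤ 9 * t := by
  obtain ⟨-, h2, j, h3⟩ := h
  exact ⟨by rw [dist_comm]; exact h3.2.1, h2.1.2.1⟩

lemma Spoke.of_agree (ht : 0 < t) {i : Fin k} {a x y : Plane} (h : Spoke k t S i a x y)
    (hag : Agree S S' a (130 * t)) : Spoke k t S' i a x y := by
  have h0 := h.dist_le
  obtain ⟨h1, h2, j, h3⟩ := h
  exact ⟨(hag y (by linarith)).1 h1, ((hag.mono (by linarith)).owns_iff ht).1 h2,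
    j, ((hag.mono (by rw [dist_self]; linarith)).inSector_iff ht).1 h3⟩

lemma Bridge.dist_le {i : Fin k} {a b x y : Plane} (h : Bridge k t S i a b x y) :
    dist a x ≤ 3 / 2 * t ∧ dist b y ≤ 3 / 2 * t ∧ dist a b ≤ 27 / 2 * t := by
  obtain ⟨h1, ⟨j, h2⟩, l, h3⟩ := h
  exact ⟨by rw [dist_comm]; exact h2.2.1, by rw [dist_comm]; exact h3.2.1, h1.2.2.2.1⟩

lemma Bridge.of_agree (ht : 0 < t) {i : Fin k} {a b x y : Plane} (h : Bridge k t S i a b x y)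
    (hag : Agree S S' a (130 * t)) : Bridge k t S' i a b x y := by
  have h0 := h.dist_le
  obtain ⟨h1, ⟨j, h2⟩, l, h3⟩ := h
  exact ⟨(hag.siteAdj_iff ht).1 h1,
    ⟨j, ((hag.mono (by rw [dist_self]; linarith)).inSector_iff ht).1 h2⟩,
    l, ((hag.mono (by rw [dist_comm]; linarith)).inSector_iff ht).1 h3⟩

lemma Edge.of_agree (ht : 0 < t) {i : Fin k} {x y : Plane} (h : Edge k t S i x y)
    (hag : Agree S S' x (200 * t)) : Edge k t S' i x y := by
  rcases h with ⟨a, h | h⟩ | ⟨a, b, h⟩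
  · have := h.dist_le
    exact Or.inl ⟨a, Or.inl (h.of_agree ht (hag.mono (by linarith)))⟩
  · have := h.dist_le
    exact Or.inl ⟨a, Or.inr (h.of_agree ht (hag.mono (by rw [dist_comm]; linarith)))⟩
  · have := h.dist_le
    exact Or.inr ⟨a, b, h.of_agree ht (hag.mono (by linarith))⟩

lemma Agree.edge_iff (ht : 0 < t) {i : Fin k} {x y : Plane} (h : Agree S S' x (200 * t)) :
    Edge k t S i x y ↔ Edge k t S' i x y :=
  ⟨fun e => e.of_agree ht h, fun e => e.of_agree ht h.symm⟩

end Locality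

/-! ### Tree paths and dense points. -/

open SimpleGraph hiding dist_comm dist_self dist

section Walks

variable {V : Type*} {G : SimpleGraph V}

lemma isPath_append {u v w : V} {p : G.Walk u v} {q : G.Walk v w} (hp : p.IsPath) (hq : q.IsPath)
    (h : ∀ z ∈ p.support, z ∈ q.support → z = v) : (p.append q).IsPath := by
  rw [Walk.isPath_def, Walk.support_append, List.nodup_append]
  have hq' := (Walk.isPath_def _).1 hq
  rw [← Walk.cons_tail_support] at hq'
  obtain ⟨h1, h2⟩ := List.nodup_cons.1 hq'
  refine ⟨(Walk.isPath_def _).1 hp, h2, fun a ha b hb hab => ?_⟩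
  subst hab
  exact h1 (h a ha (List.mem_of_mem_tail hb) ▸ hb)

/-- From any starting point of a walk ending in `A` there is a path meeting `A` only at its end. -/
lemma exists_path_first_hit (A : Set V) {w u : V} (q : G.Walk w u) (hu : u ∈ A) :
    ∃ x ∈ A, ∃ q' : G.Walk w x, q'.IsPath ∧ ∀ z ∈ q'.support, z ∈ A → z = x := by
  classical
  induction q with
  | nil => exact ⟨_, hu, Walk.nil, Walk.IsPath.nil, by simp⟩
  | @cons w w' u h q ih =>
    by_cases hw : w ∈ A
    · exact ⟨w, hw, Walk.nil, Walk.IsPath.nil, by simp⟩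
    obtain ⟨x, hx, q', -, hq'⟩ := ih hu
    refine ⟨x, hx, (Walk.cons h q').bypass, Walk.bypass_isPath _, fun z hz hzA => ?_⟩
    have := Walk.support_bypass_subset_support _ hz
    rw [Walk.support_cons, List.mem_cons] at this
    rcases this with rfl | hz
    · exact absurd hzA hw
    · exact hq' z hz hzA

lemma exists_longest_path [Finite V] [Nonempty V] :
    ∃ (u v : V) (p : G.Walk u v), p.IsPath ∧
      ∀ (u' v' : V) (p' : G.Walk u' v'), p'.IsPath → p'.length ≤ p.length := by
  classical
  have := Fintype.ofFinite V
  set P : ℕ → Prop := fun n => ∃ (u v : V) (p : G.Walk u v), p.IsPath ∧ p.length = n with hP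
  have h0 : P 0 := ⟨Classical.arbitrary V, _, Walk.nil, Walk.IsPath.nil, rfl⟩
  have hb : ∀ n, P n → n ≤ Fintype.card V := by
    rintro n ⟨u, v, p, hp, rfl⟩
    exact hp.length_lt.le
  obtain ⟨u, v, p, hp, hn⟩ := Nat.findGreatest_spec (P := P) (Nat.zero_le (Fintype.card V)) h0
  refine ⟨u, v, p, hp, fun u' v' p' hp' => ?_⟩
  rw [hn]
  exact Nat.le_findGreatest (hb _ ⟨u', v', p', hp', rfl⟩) ⟨u', v', p', hp', rfl⟩

end Walks

section Spanning

variable {k : ℕ} {β : ℝ} {S : Finset Plane} {T : SimpleGraph S}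

lemma dist_getVert_le (hT : ∀ u v : S, T.Adj u v → dist (u : Plane) v ≤ β) (hβ : 0 ≤ β) {u v : S}
    (p : T.Walk u v) {i j : ℕ} (hij : i ≤ j) :
    dist (p.getVert i : Plane) (p.getVert j) ≤ ((j : ℝ) - i) * β := by
  induction j, hij using Nat.le_induction with
  | base => simp
  | succ j hij ih =>
    have h1 : dist (p.getVert j : Plane) (p.getVert (j + 1)) ≤ β := by
      rcases lt_or_ge j p.length with h | h
      · exact hT _ _ (p.adj_getVert_succ h)
      · rw [p.getVert_of_length_le h, p.getVert_of_length_le (by omega), dist_self]; exact hβ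
    have := dist_triangle (p.getVert i : Plane) (p.getVert j) (p.getVert (j + 1))
    push_cast
    linarith

lemma dist_le_length_mul (hT : ∀ u v : S, T.Adj u v → dist (u : Plane) v ≤ β) (hβ : 0 ≤ β) {u v : S}
    (p : T.Walk u v) : dist (u : Plane) v ≤ p.length * β := by
  have := dist_getVert_le hT hβ p (Nat.zero_le p.length)
  rw [Walk.getVert_zero, Walk.getVert_length] at this
  simpa using this

lemma half_mul_le (hβ : 0 ≤ β) : ((3 * k / 2 : ℕ) : ℝ) * β ≤ 3 / 2 * (k * β) := by
  have h : ((2 * (3 * k / 2) : ℕ) : ℝ) ≤ ((3 * k : ℕ) : ℝ) := by exact_mod_cast Nat.mul_div_le _ _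
  push_cast at h
  have := mul_le_mul_of_nonneg_right h hβ
  linarith

/-- With h = ⌊3k/2⌋, the 2h+1 ≥ 3k path vertices at most h steps away are distinct and lie within hβ
≤ 3t/2. -/
lemma dense_getVert (hT : ∀ u v : S, T.Adj u v → dist (u : Plane) v ≤ β) (hβ : 0 ≤ β) {u v : S}
    {p : T.Walk u v} (hp : p.IsPath) {j : ℕ} (h1 : 3 * k / 2 ≤ j)
    (h2 : j + 3 * k / 2 ≤ p.length) : Dense k (k * β) S (p.getVert j) := by
  classical
  refine ⟨(p.getVert j).2, ?_⟩
  set h := 3 * k / 2 with hh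
  have hhβ : (h : ℝ) * β ≤ 3 / 2 * (k * β) := half_mul_le hβ
  have hsub : (Finset.Icc (j - h) (j + h)).image (fun i => (p.getVert i : Plane)) ⊆
      localView S (p.getVert j) (3 / 2 * (k * β)) := by
    intro z hz
    obtain ⟨i, hi, rfl⟩ := Finset.mem_image.1 hz
    rw [Finset.mem_Icc] at hi
    refine Finset.mem_filter.2 ⟨(p.getVert i).2, le_trans ?_ hhβ⟩
    rcases le_total i j with hij | hij
    · rw [dist_comm]
      refine (dist_getVert_le hT hβ p hij).trans (mul_le_mul_of_nonneg_right ?_ hβ)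
      have : (j : ℝ) ≤ i + h := by exact_mod_cast (by omega : j ≤ i + h)
      linarith
    · refine (dist_getVert_le hT hβ p hij).trans (mul_le_mul_of_nonneg_right ?_ hβ)
      have : (i : ℝ) ≤ j + h := by exact_mod_cast hi.2
      linarith
  refine le_trans ?_ (Finset.card_le_card hsub)
  rw [Finset.card_image_of_injOn, Nat.card_Icc]
  · omega
  · intro x hx y hy hxy
    rw [Finset.mem_coe, Finset.mem_Icc] at hx hy
    refine hp.getVert_injOn ?_ ?_ (Subtype.ext hxy)
    · show x ≤ p.length; omega
    · show y ≤ p.length; omega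

/-- If the longest path has at least 2h edges, h = ⌊3k/2⌋, its h-th vertex is dense. Otherwise its
middle vertex sees all of `S`: a branch leaving the path at `x` is no longer than either part of the
path at `x`, or the path could be lengthened, so each vertex is at most h steps from the middle. -/
lemma exists_dense (hconn : T.Connected) (hT : ∀ u v : S, T.Adj u v → dist (u : Plane) v ≤ β)
    (hβ : 0 ≤ β) (hcard : 3 * k ≤ S.card) : ∃ v : S, Dense k (k * β) S v := by
  classical
  have := hconn.nonempty
  obtain ⟨u, v, p, hp, hmax⟩ := exists_longest_path (G := T)
  by_cases hlen : 3 * k / 2 + 3 * k / 2 ≤ p.length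
  · exact ⟨_, dense_getVert hT hβ hp le_rfl hlen⟩
  refine ⟨p.getVert (p.length / 2), (p.getVert _).2, ?_⟩
  have hall : localView S (p.getVert (p.length / 2)) (3 / 2 * (k * β)) = S := by
    refine Finset.filter_true_of_mem fun w hw => le_trans ?_ (half_mul_le hβ)
    obtain ⟨q⟩ := hconn.preconnected ⟨w, hw⟩ u
    obtain ⟨x, hx, q', hq', hhit⟩ := exists_path_first_hit {z | z ∈ p.support} q p.start_mem_support
    have hx' : x ∈ p.support := hx
    have hlenadd := congrArg Walk.length (p.take_spec hx')
    rw [Walk.length_append] at hlenadd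
    have hA : q'.length ≤ (p.takeUntil x hx').length := by
      have h1 := isPath_append hq' (hp.dropUntil hx') fun z hz hz' =>
        hhit z hz (p.support_dropUntil_subset_support hx' hz')
      have h2 := hmax _ _ _ h1
      rw [Walk.length_append] at h2
      omega
    have hB : q'.length ≤ (p.dropUntil x hx').length := by
      have h1 := isPath_append hq' (hp.takeUntil hx').reverse fun z hz hz' =>
        hhit z hz (p.support_takeUntil_subset_support hx' (by simpa using hz'))
      have h2 := hmax _ _ _ h1
      rw [Walk.length_append, Walk.length_reverse] at h2
      omega
    have hd := dist_le_length_mul hT hβ q'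
    have hgx := Walk.getVert_length_takeUntil hx'
    rw [dist_comm]
    refine (dist_triangle w x _).trans ?_
    generalize (p.takeUntil x hx').length = j at hgx hA hlenadd
    generalize (p.dropUntil x hx').length = j' at hB hlenadd
    generalize q'.length = l at hd hA hB
    simp only at hd
    rw [← hgx] at hd ⊢
    set m := p.length / 2 with hm
    have hd2 : dist (p.getVert j : Plane) (p.getVert m) ≤ (((3 * k / 2 : ℕ) : ℝ) - l) * β := by
      rcases le_total j m with h | h
      · refine (dist_getVert_le hT hβ p h).trans (mul_le_mul_of_nonneg_right ?_ hβ)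
        have : (m : ℝ) + l ≤ j + (3 * k / 2 : ℕ) := by
          exact_mod_cast (by omega : m + l ≤ j + 3 * k / 2)
        linarith
      · rw [dist_comm]
        refine (dist_getVert_le hT hβ p h).trans (mul_le_mul_of_nonneg_right ?_ hβ)
        have : (j : ℝ) + l ≤ m + (3 * k / 2 : ℕ) := by
          exact_mod_cast (by omega : j + l ≤ m + 3 * k / 2)
        linarith
    linarith
  rw [hall]
  exact hcard

/-- A path from `x` with 2h edges, h = ⌊3k/2⌋, has a dense vertex after h steps. If there is none,
every vertex is fewer than 2h steps away, in particular some dense one. -/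
lemma exists_dense_near (hconn : T.Connected)
    (hT : ∀ u v : S, T.Adj u v → dist (u : Plane) v ≤ β) (hβ : 0 ≤ β)
    (hcard : 3 * k ≤ S.card) (x : S) :
    ∃ v : S, Dense k (k * β) S v ∧ dist (x : Plane) v ≤ 3 * (k * β) := by
  have hh := half_mul_le (k := k) hβ
  have hk : 0 ≤ k * β := by positivity
  by_cases h : ∃ (y : S) (p : T.Walk x y), p.IsPath ∧ 3 * k / 2 + 3 * k / 2 ≤ p.length
  · obtain ⟨y, p, hp, hlen⟩ := h
    refine ⟨_, dense_getVert hT hβ hp le_rfl hlen, ?_⟩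
    have := dist_getVert_le hT hβ p (Nat.zero_le (3 * k / 2))
    rw [Walk.getVert_zero, Nat.cast_zero, sub_zero] at this
    linarith
  · push Not at h
    obtain ⟨v, hv⟩ := exists_dense hconn hT hβ hcard
    refine ⟨v, hv, ?_⟩
    obtain ⟨p, hp⟩ := hconn.exists_isPath x v
    have h1 := dist_le_length_mul hT hβ p
    have h2 : (p.length : ℝ) ≤ (3 * k / 2 : ℕ) + (3 * k / 2 : ℕ) := by
      exact_mod_cast (h v p hp).le
    have := mul_le_mul_of_nonneg_right h2 hβ
    linarith

/-- Every partition of the sites is crossed by a pair of sites at distance at most `27t/2`. -/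
lemma exists_cross_pair (hk : 1 ≤ k) (hconn : T.Connected)
    (hT : ∀ u v : S, T.Adj u v → dist (u : Plane) v ≤ β) (hβ : 0 < β) (U : Set Plane)
    {a b : Plane} (ha : Site k (k * β) S a) (hb : Site k (k * β) S b) (haU : a ∈ U) (hbU : b ∉ U) :
    ∃ a' b', Site k (k * β) S a' ∧ Site k (k * β) S b' ∧ a' ∈ U ∧ b' ∉ U ∧
      dist a' b' ≤ 27 / 2 * (k * β) := by
  have hk' : (1 : ℝ) ≤ k := by exact_mod_cast hk
  have ht : 0 < k * β := by positivity
  have hβt : β ≤ k * β := by nlinarith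
  have hh := half_mul_le (k := k) hβ.le
  by_contra! hcon
  have hab := hcon a b ha hb haU hbU
  obtain ⟨p, hp⟩ := hconn.exists_isPath ⟨a, ha.mem⟩ ⟨b, hb.mem⟩
  have hlen : 3 * k / 2 + 3 * k / 2 ≤ p.length := by
    by_contra hlt
    have h1 := dist_le_length_mul hT hβ.le p
    have h2 : (p.length : ℝ) ≤ (3 * k / 2 : ℕ) + (3 * k / 2 : ℕ) := by
      exact_mod_cast (not_le.1 hlt).le
    have := mul_le_mul_of_nonneg_right h2 hβ.le
    simp only at h1
    linarith
  -- Sites near consecutive dense vertices are at most 6t + β + 6t ≤ 13t apart, so they cannot leave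
  -- `U`. At both ends of the path the jump is at most 3t/2 + 6t.
  have chain : ∀ j, 3 * k / 2 ≤ j → j + 3 * k / 2 ≤ p.length →
      ∃ s, Site k (k * β) S s ∧ s ∈ U ∧ dist (p.getVert j : Plane) s ≤ 6 * (k * β) := by
    intro j hj
    induction j, hj using Nat.le_induction with
    | base =>
      intro h
      obtain ⟨s, hs, hd⟩ := (dense_getVert hT hβ.le hp le_rfl h).exists_site ht
      refine ⟨s, hs, ?_, hd⟩
      by_contra hsU
      have h1 := hcon a s ha hs haU hsU
      have h2 := dist_getVert_le hT hβ.le p (Nat.zero_le (3 * k / 2))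
      rw [Walk.getVert_zero, Nat.cast_zero, sub_zero] at h2
      have := dist_triangle a (p.getVert (3 * k / 2)) s
      simp only at h2
      linarith
    | succ j hj ih =>
      intro h
      obtain ⟨s', hs', hsU', hd'⟩ := ih (by omega)
      obtain ⟨s, hs, hd⟩ := (dense_getVert hT hβ.le hp (by omega) h).exists_site ht
      refine ⟨s, hs, ?_, hd⟩
      by_contra hsU
      have h1 := hcon s' s hs' hs hsU' hsU
      have h2 := dist_getVert_le hT hβ.le p (Nat.le_succ j)
      push_cast at h2
      have h3 := dist_triangle4 s' (p.getVert j) (p.getVert (j + 1)) s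
      rw [dist_comm] at hd'
      linarith
  obtain ⟨s, hs, hsU, hd⟩ := chain (p.length - 3 * k / 2) (by omega) (by omega)
  have h1 := hcon s b hs hb hsU hbU
  have h2 := dist_getVert_le hT hβ.le p (Nat.sub_le p.length (3 * k / 2))
  rw [Walk.getVert_length, Nat.cast_sub (by omega), sub_sub_cancel] at h2
  have h3 := dist_triangle s (p.getVert (p.length - 3 * k / 2)) b
  rw [dist_comm] at hd
  simp only at h2
  linarith

end Spanning

/-! ### Edges attached to a common site. -/

lemma exists_eq_smul_of_mem_segment {x y z : Plane} (hz : z ∈ segment ℝ x y) (hne : z ≠ x) :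
    ∃ r : ℝ, y = r • (z - x) +ᵥ x := by
  rw [segment_eq_image'] at hz
  obtain ⟨s, -, rfl⟩ := hz
  have hs : s ≠ 0 := by
    rintro rfl
    simp at hne
  refine ⟨s⁻¹, ?_⟩
  rw [add_sub_cancel_left, smul_smul, inv_mul_cancel₀ hs, one_smul, vadd_eq_add, sub_add_cancel]

/-- Two segments from `x` to points not collinear with `x` meet only in `x`. -/
lemma GeneralPosition.eq_of_mem_segment {S : Finset Plane} (hS : GeneralPosition S) {x y y' z : Plane}
    (hx : x ∈ S) (hy : y ∈ S) (hy' : y' ∈ S) (hxy : x ≠ y) (hxy' : x ≠ y') (hyy' : y ≠ y')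
    (hz : z ∈ segment ℝ x y) (hz' : z ∈ segment ℝ x y') : z = x := by
  by_contra hne
  refine hS x hx y hy y' hy' hxy hyy' hxy' ?_
  rw [collinear_iff_of_mem (p₀ := x) (by simp)]
  refine ⟨z - x, ?_⟩
  rintro p (rfl | rfl | rfl)
  · exact ⟨0, by simp⟩
  · exact exists_eq_smul_of_mem_segment hz hne
  · exact exists_eq_smul_of_mem_segment hz' hne

section Fans

variable {k : ℕ} {t : ℝ} {S : Finset Plane} {i i' : Fin k} {a b x y : Plane}

lemma mem_localView {p q : Plane} {r : ℝ} : q ∈ localView S p r ↔ q ∈ S ∧ dist p q ≤ r := by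
  simp [localView]

lemma Site.isFan (hk : 1 ≤ k) (ht : 0 < t) (hS : GeneralPosition S) (ha : Site k t S a) :
    IsFan k (localView S a (3 / 2 * t)) (localView S a (20 * t)) (fan k t S a).1
      (fan k t S a).2 := by
  have hsub : localView S a (3 / 2 * t) ⊆ S := Finset.filter_subset _ _
  obtain ⟨c, h, hf⟩ := exists_isFan hk (C := localView S a (3 / 2 * t))
    (Q := localView S a (20 * t))
    (fun p hp q hq s hs => hS p (hsub hp) q (hsub hq) s (hsub hs)) ha.dense.2 (fun p hp => by
      rw [mem_localView] at hp ⊢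
      exact ⟨hp.1, by linarith [hp.2]⟩)
  exact Classical.epsilon_spec (p := fun f : Plane × (Fin k → Fin 3 → Plane) =>
    IsFan k (localView S a (3 / 2 * t)) (localView S a (20 * t)) f.1 f.2) ⟨(c, h), hf⟩

lemma IsFan.dist_center_le {r : ℝ} {Q : Finset Plane} {c : Plane} {h : Fin k → Fin 3 → Plane}
    (hf : IsFan k (localView S a r) Q c h) : dist c a ≤ r := by
  have : convexHull ℝ (localView S a r : Set Plane) ⊆ Metric.closedBall a r := by
    refine convexHull_min (fun p hp => ?_) (convex_closedBall a r)
    rw [Metric.mem_closedBall, dist_comm]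
    exact (mem_localView.1 hp).2
  exact Metric.mem_closedBall.1 (this hf.center_mem)

lemma IsFan.hub_mem_dist {r : ℝ} {Q : Finset Plane} {c : Plane} {h : Fin k → Fin 3 → Plane}
    (hf : IsFan k (localView S a r) Q c h) (i : Fin k) (j : Fin 3) :
    h i j ∈ S ∧ dist (h i j) a ≤ r := by
  have := mem_localView.1 (hf.hub_mem i j)
  exact ⟨this.1, by rw [dist_comm]; exact this.2⟩

/-- Sites are more than `6t` apart, so the disc of radius `3t/2` that contains the hubs is interior
to the Voronoi cell. -/
lemma Site.dist_lt_of_dist_le (ht : 0 < t) (ha : Site k t S a) (hb : Site k t S b) (hne : b ≠ a)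
    (hy : dist y a ≤ 3 / 2 * t) : dist y a < dist y b := by
  have h1 := ha.lt_dist ht hb hne.symm
  have h2 := dist_triangle_left a b y
  linarith

lemma Owns.unique (ha : Owns k t S a y) (hb : Owns k t S b y) : a = b := ha.2.trans hb.2.symm

lemma owns_of_dist_le (ht : 0 < t) (ha : Site k t S a) (hy : dist y a ≤ 3 / 2 * t) :
    Owns k t S a y := by
  have hn : Nearest k t S y a := ⟨ha, by linarith, fun d hd => by
    by_cases h : d = a
    · rw [h]
    · exact (ha.dist_lt_of_dist_le ht hd h hy).le⟩
  refine ⟨hn, ?_⟩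
  have he : Nearest k t S y (Classical.epsilon (Nearest k t S y)) := Classical.epsilon_spec ⟨a, hn⟩
  by_contra hne
  exact absurd (he.2.2 a ha) (not_le.2 (ha.dist_lt_of_dist_le ht he.1 (Ne.symm hne) hy))

lemma exists_owns (h : ∃ a, Site k t S a ∧ dist y a ≤ 9 * t) : ∃ a, Owns k t S a y := by
  obtain ⟨a, ha, hd⟩ := h
  have hfin : {d | Site k t S d}.Finite := S.finite_toSet.subset fun d hd => Site.mem hd
  obtain ⟨m, hm, hmin⟩ := Set.exists_min_image _ (fun d => dist y d) hfin ⟨a, ha⟩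
  have hn : Nearest k t S y m := ⟨hm, (hmin a ha).trans hd, hmin⟩
  exact ⟨_, Classical.epsilon_spec ⟨m, hn⟩, rfl⟩

lemma InSector.mem {j : Fin 3} (hk : 1 ≤ k) (ht : 0 < t) (hS : GeneralPosition S)
    (ha : Site k t S a) (h : InSector k t S i a j x y) : x ∈ S := by
  rw [h.1]; exact ((ha.isFan hk ht hS).hub_mem_dist i j).1

lemma InSector.ne {j : Fin 3} (h : InSector k t S i a j x y) : x ≠ y := by
  rw [h.1]; exact h.2.2.ne

lemma InSector.det_pos {j : Fin 3} (h : InSector k t S i a j x y) : 0 < det (fan k t S a).1 x y := by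
  rw [h.1]; exact h.2.2.1

lemma InSector.layer_eq {j j' : Fin 3} {y' : Plane} (hk : 1 ≤ k) (ht : 0 < t)
    (hS : GeneralPosition S) (ha : Site k t S a) (h : InSector k t S i a j x y)
    (h' : InSector k t S i' a j' x y') : i = i' :=
  ((ha.isFan hk ht hS).hub_inj i j i' j' (h.1.symm.trans h'.1)).1

/-- Edges at the same hub are separated by general position, edges at different hubs by their
sectors. -/
lemma InSector.inter {j l : Fin 3} {x' y' z : Plane} (hk : 1 ≤ k) (ht : 0 < t)
    (hS : GeneralPosition S) (ha : Site k t S a) (h : InSector k t S i a j x y)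
    (h' : InSector k t S i a l x' y') (hy : y ∈ S) (hy' : y' ∈ S) (hne : s(x, y) ≠ s(x', y'))
    (hz : z ∈ segment ℝ x y) (hz' : z ∈ segment ℝ x' y') :
    (z = x ∨ z = y) ∧ (z = x' ∨ z = y') := by
  by_cases hjl : j = l
  · subst hjl
    have hxx : x = x' := h.1.trans h'.1.symm
    subst hxx
    have := hS.eq_of_mem_segment (h.mem hk ht hS ha) hy hy' h.ne h'.ne
      (fun e => hne (by rw [e])) hz hz'
    exact ⟨Or.inl this, Or.inl this⟩
  · have hf := ha.isFan hk ht hS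
    rw [h.1] at hz ⊢
    rw [h'.1] at hz' ⊢
    exact InArc.inter_of_ne (hf.det_pos i) hjl h.2.2 h'.2.2 hz hz'

/-- The edge `x y` is attached to a hub of the site `a`. -/
def Incident (k : ℕ) (t : ℝ) (S : Finset Plane) (i : Fin k) (a x y : Plane) : Prop :=
  (∃ j, InSector k t S i a j x y) ∨ ∃ j, InSector k t S i a j y x

lemma Incident.inter {x' y' z : Plane} (hk : 1 ≤ k) (ht : 0 < t)
    (hS : GeneralPosition S) (ha : Site k t S a) (h : Incident k t S i a x y)
    (h' : Incident k t S i a x' y') (hx : x ∈ S) (hy : y ∈ S) (hx' : x' ∈ S) (hy' : y' ∈ S)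
    (hne : s(x, y) ≠ s(x', y'))
    (hz : z ∈ segment ℝ x y) (hz' : z ∈ segment ℝ x' y') :
    (z = x ∨ z = y) ∧ (z = x' ∨ z = y') := by
  rcases h with ⟨j, h⟩ | ⟨j, h⟩ <;> rcases h' with ⟨l, h'⟩ | ⟨l, h'⟩
  · exact h.inter hk ht hS ha h' hy hy' hne hz hz'
  · rw [segment_symm] at hz'
    rw [Sym2.eq_swap (a := x')] at hne
    have := h.inter hk ht hS ha h' hy hx' hne hz hz'
    exact ⟨this.1, this.2.symm⟩
  · rw [segment_symm] at hz
    rw [Sym2.eq_swap (a := x)] at hne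
    have := h.inter hk ht hS ha h' hx hy' hne hz hz'
    exact ⟨this.1.symm, this.2⟩
  · rw [segment_symm] at hz hz'
    rw [Sym2.eq_swap (a := x), Sym2.eq_swap (a := x')] at hne
    have := h.inter hk ht hS ha h' hx hx' hne hz hz'
    exact ⟨this.1.symm, this.2.symm⟩

end Fans

/-! ### Planarity and edge-disjointness of the layers. -/

section Edges

variable {k : ℕ} {t : ℝ} {S : Finset Plane} {i i' : Fin k} {a b x y : Plane}

lemma SiteAdj.symm (h : SiteAdj k t S a b) : SiteAdj k t S b a := by
  obtain ⟨h1, h2, h3, h4, h5⟩ := h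
  refine ⟨h2, h1, h3.symm, by rwa [dist_comm], fun d hd => ?_⟩
  rw [dist_comm b a]
  exact (h5 d hd).symm

lemma Bridge.symm (h : Bridge k t S i a b x y) : Bridge k t S i b a y x :=
  ⟨h.1.symm, h.2.2, h.2.1⟩

lemma Edge.symm (h : Edge k t S i x y) : Edge k t S i y x := by
  rcases h with ⟨a, h⟩ | ⟨a, b, h⟩
  · exact Or.inl ⟨a, h.symm⟩
  · exact Or.inr ⟨b, a, h.symm⟩

lemma Spoke.site (h : Spoke k t S i a x y) : Site k t S a := h.2.1.1.1

lemma Spoke.owns_left (ht : 0 < t) (h : Spoke k t S i a x y) : Owns k t S a x := by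
  obtain ⟨-, h1, j, h2⟩ := h
  exact owns_of_dist_le ht h1.1.1 h2.2.1

lemma Bridge.owns_left (ht : 0 < t) (h : Bridge k t S i a b x y) : Owns k t S a x := by
  obtain ⟨h1, ⟨j, h2⟩, -⟩ := h
  exact owns_of_dist_le ht h1.1 h2.2.1

lemma Edge.mem (hk : 1 ≤ k) (ht : 0 < t) (hS : GeneralPosition S) (h : Edge k t S i x y) :
    x ∈ S ∧ y ∈ S := by
  rcases h with ⟨a, ⟨h1, h2, j, h3⟩ | ⟨h1, h2, j, h3⟩⟩ | ⟨a, b, h1, ⟨j, h2⟩, l, h3⟩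
  · exact ⟨h3.mem hk ht hS h2.1.1, h1⟩
  · exact ⟨h1, h3.mem hk ht hS h2.1.1⟩
  · exact ⟨h2.mem hk ht hS h1.1, h3.mem hk ht hS h1.2.1⟩

lemma Edge.ne (h : Edge k t S i x y) : x ≠ y := by
  rcases h with ⟨a, ⟨h1, h2, j, h3⟩ | ⟨h1, h2, j, h3⟩⟩ | ⟨a, b, h1, ⟨j, h2⟩, l, h3⟩
  · exact h3.ne
  · exact h3.ne.symm
  · exact h2.ne

lemma Edge.dist_le (ht : 0 < t) (h : Edge k t S i x y) : dist x y ≤ 33 / 2 * t := by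
  rcases h with ⟨a, h | h⟩ | ⟨a, b, h⟩
  · have := h.dist_le
    linarith [dist_triangle_left x y a, dist_comm y a]
  · have := h.dist_le
    linarith [dist_triangle_left x y a, dist_comm x a]
  · have := h.dist_le
    linarith [dist_triangle4 x a b y, dist_comm x a]

lemma Spoke.owns_or_lt (ht : 0 < t) {z d : Plane} (h : Spoke k t S i a x y)
    (hd : Site k t S d) (hne : d ≠ a) (hz : z ∈ segment ℝ x y) :
    z = y ∨ dist z a < dist z d := by
  obtain ⟨-, h1, j, h2⟩ := h
  exact dist_lt_of_mem_segment (h1.1.1.dist_lt_of_dist_le ht hd hne h2.2.1) (h1.1.2.2 d hd) hz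

/-- Every edge is attached to one or two sites, and stays in their Voronoi cells. -/
lemma Edge.exists_sites (ht : 0 < t) (h : Edge k t S i x y) :
    ∃ a b, Site k t S a ∧ Site k t S b ∧ Incident k t S i a x y ∧ Incident k t S i b x y ∧
      ∀ z ∈ segment ℝ x y, (a = b ∧ Owns k t S a z) ∨
        ∀ d, Site k t S d → d ≠ a → d ≠ b → dist z a < dist z d ∨ dist z b < dist z d := by
  have spoke : ∀ {a x y}, Spoke k t S i a x y → ∀ z ∈ segment ℝ x y, (a = a ∧ Owns k t S a z) ∨
        ∀ d, Site k t S d → d ≠ a → d ≠ a → dist z a < dist z d ∨ dist z a < dist z d := by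
    intro a x y h z hz
    -- The owned end may be equally near to several sites, so there ownership replaces the strict
    -- inequality.
    by_cases hzy : z = y
    · left; rw [hzy]; exact ⟨rfl, h.2.1⟩
    · right
      exact fun d hd hda _ => Or.inl ((h.owns_or_lt ht hd hda hz).resolve_left hzy)
  rcases h with ⟨a, h | h⟩ | ⟨a, b, h⟩
  · exact ⟨a, a, h.site, h.site, Or.inl h.2.2, Or.inl h.2.2, spoke h⟩
  · refine ⟨a, a, h.site, h.site, Or.inr h.2.2, Or.inr h.2.2, ?_⟩
    rw [segment_symm]
    exact spoke h
  · refine ⟨a, b, h.1.1, h.1.2.1, Or.inl h.2.1, Or.inr h.2.2, fun z hz => Or.inr ?_⟩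
    obtain ⟨⟨ha, hb, hab, -, hrng⟩, ⟨j, h2⟩, l, h3⟩ := h
    intro d hd hda hdb
    have h4 := ha.lt_dist ht hd hda.symm
    have h5 := hb.lt_dist ht hd hdb.symm
    exact dist_lt_of_mem_thick_segment h2.2.1 h3.2.1 hab (by linarith) (by linarith) (hrng d hd) hz

/-- Edges with a common site are covered by `Incident.inter`. Without one, a common point would have
a nearest site among those of the first edge and one among those of the second, against strictness
or the uniqueness of owners. -/
lemma Edge.inter (hk : 1 ≤ k) (ht : 0 < t) (hS : GeneralPosition S) {x' y' z : Plane}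
    (h : Edge k t S i x y) (h' : Edge k t S i x' y') (hne : s(x, y) ≠ s(x', y'))
    (hz : z ∈ segment ℝ x y) (hz' : z ∈ segment ℝ x' y') :
    (z = x ∨ z = y) ∧ (z = x' ∨ z = y') := by
  obtain ⟨hx, hy⟩ := h.mem hk ht hS
  obtain ⟨hx', hy'⟩ := h'.mem hk ht hS
  obtain ⟨a, b, ha, hb, hia, hib, hv⟩ := h.exists_sites ht
  obtain ⟨a', b', ha', hb', hia', hib', hv'⟩ := h'.exists_sites ht
  by_cases h1 : a = a'
  · subst h1; exact hia.inter hk ht hS ha hia' hx hy hx' hy' hne hz hz'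
  by_cases h2 : a = b'
  · subst h2; exact hia.inter hk ht hS ha hib' hx hy hx' hy' hne hz hz'
  by_cases h3 : b = a'
  · subst h3; exact hib.inter hk ht hS hb hia' hx hy hx' hy' hne hz hz'
  by_cases h4 : b = b'
  · subst h4; exact hib.inter hk ht hS hb hib' hx hy hx' hy' hne hz hz'
  exfalso
  rcases hv z hz with ⟨-, ho⟩ | hv <;> rcases hv' z hz' with ⟨-, ho'⟩ | hv'
  · exact h1 (ho.unique ho')
  · have e1 := ho.1.2.2 a' ha'
    have e2 := ho.1.2.2 b' hb'
    rcases hv' a ha h1 h2 with e | e <;> linarith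
  · have e1 := ho'.1.2.2 a ha
    have e2 := ho'.1.2.2 b hb
    rcases hv a' ha' (Ne.symm h1) (Ne.symm h3) with e | e <;> linarith
  · rcases hv a' ha' (Ne.symm h1) (Ne.symm h3) with e1 | e1 <;>
    rcases hv b' hb' (Ne.symm h2) (Ne.symm h4) with e2 | e2 <;>
    rcases hv' a ha h1 h2 with e3 | e3 <;> rcases hv' b hb h3 h4 with e4 | e4 <;> linarith

/-- The ends of a spoke have the same owner, those of a bridge have different ones. -/
lemma Spoke.not_bridge (ht : 0 < t) (h : Spoke k t S i a x y) {a' b' : Plane}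
    (h' : Bridge k t S i' a' b' x y) : False :=
  h'.1.2.2.1 (((h'.owns_left ht).unique (h.owns_left ht)).trans
    (h.2.1.unique (h'.symm.owns_left ht)))

lemma Spoke.not_spoke (hk : 1 ≤ k) (ht : 0 < t) (hS : GeneralPosition S) (hi : i ≠ i')
    (h : Spoke k t S i a x y) (h' : Spoke k t S i' b x y) : False := by
  obtain rfl := h.2.1.unique h'.2.1
  have ha := h.site
  obtain ⟨-, -, j, h1⟩ := h
  obtain ⟨-, -, j', h2⟩ := h'
  exact hi (h1.layer_eq hk ht hS ha h2)

/-- Each end would lie counterclockwise of the other about the same centre. This also excludes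
coincidences between two layers in which the hub roles are exchanged. -/
lemma Spoke.not_spoke_swap (ht : 0 < t) (h : Spoke k t S i a x y) (h' : Spoke k t S i' b y x) :
    False := by
  obtain rfl := h.2.1.unique (h'.owns_left ht)
  obtain ⟨-, -, j, h1⟩ := h
  obtain ⟨-, -, j', h2⟩ := h'
  have e1 := h1.det_pos
  have e2 := h2.det_pos
  rw [det_swap] at e2
  linarith

lemma Edge.layer_eq (hk : 1 ≤ k) (ht : 0 < t) (hS : GeneralPosition S)
    (h : Edge k t S i x y) (h' : Edge k t S i' x y) : i = i' := by
  by_contra hi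
  rcases h with ⟨a, h | h⟩ | ⟨a, b, h⟩ <;> rcases h' with ⟨a', h' | h'⟩ | ⟨a', b', h'⟩
  · exact h.not_spoke hk ht hS hi h'
  · exact h.not_spoke_swap ht h'
  · exact h.not_bridge ht h'
  · exact h.not_spoke_swap ht h'
  · exact h.not_spoke hk ht hS hi h'
  · exact h.not_bridge ht h'.symm
  · exact h'.not_bridge ht h
  · exact h'.not_bridge ht h.symm
  · obtain rfl := (h.owns_left ht).unique (h'.owns_left ht)
    obtain ⟨h1, ⟨j, h2⟩, -⟩ := h
    obtain ⟨-, ⟨j', h3⟩, -⟩ := h'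
    exact hi (h2.layer_eq hk ht hS h1.1 h3)

end Edges

/-! ### Connectedness of the layers. -/

section Connectedness

open Relation

variable {k : ℕ} {t : ℝ} {S : Finset Plane} {i : Fin k} {a b x y : Plane}

lemma reach_symm (h : ReflTransGen (Edge k t S i) x y) : ReflTransGen (Edge k t S i) y x := by
  have : Std.Symm (Edge k t S i) := ⟨fun _ _ e => Edge.symm e⟩
  exact ReflTransGen.stdSymm.symm _ _ h

lemma Site.hub_spoke (hk : 1 ≤ k) (ht : 0 < t) (hS : GeneralPosition S) (ha : Site k t S a)
    {j : Fin 3} (hy : y ∈ S) (ho : Owns k t S a y)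
    (harc : InArc (fan k t S a).1 ((fan k t S a).2 i) j y) :
    Edge k t S i ((fan k t S a).2 i j) y :=
  Or.inl ⟨a, Or.inl ⟨hy, ho, j, rfl, ((ha.isFan hk ht hS).hub_mem_dist i j).2, harc⟩⟩

lemma Site.reach_hub (hk : 1 ≤ k) (ht : 0 < t) (hS : GeneralPosition S) (ha : Site k t S a)
    (j : Fin 3) : ReflTransGen (Edge k t S i) ((fan k t S a).2 i 0) ((fan k t S a).2 i j) := by
  have hf := ha.isFan hk ht hS
  have step : ∀ j, Edge k t S i ((fan k t S a).2 i j) ((fan k t S a).2 i (j + 1)) := fun j =>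
    ha.hub_spoke hk ht hS (hf.hub_mem_dist i _).1 (owns_of_dist_le ht ha (hf.hub_mem_dist i _).2)
      ⟨hf.det_pos i j, Or.inl rfl⟩
  have h1 : ReflTransGen (Edge k t S i) ((fan k t S a).2 i 0) ((fan k t S a).2 i 1) :=
    ReflTransGen.single (step 0)
  fin_cases j
  · exact ReflTransGen.refl
  · exact h1
  · exact h1.tail (step 1)

lemma Owns.reach (hk : 1 ≤ k) (ht : 0 < t) (hS : GeneralPosition S) (hy : y ∈ S)
    (ho : Owns k t S a y) : ReflTransGen (Edge k t S i) ((fan k t S a).2 i 0) y := by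
  have ha := ho.1.1
  have hf := ha.isFan hk ht hS
  obtain ⟨j, hj⟩ := exists_inArc (hf.det_pos i) (y := y) fun j hne =>
    hf.generic _ (mem_localView.2 ⟨(hf.hub_mem_dist i j).1, by
      rw [dist_comm]; linarith [(hf.hub_mem_dist i j).2]⟩) y
      (mem_localView.2 ⟨hy, by rw [dist_comm]; linarith [ho.1.2.1]⟩) hne.symm
  exact (ha.reach_hub hk ht hS j).tail (ha.hub_spoke hk ht hS hy ho hj)

lemma SiteAdj.reach (hk : 1 ≤ k) (ht : 0 < t) (hS : GeneralPosition S) (hab : SiteAdj k t S a b) :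
    ReflTransGen (Edge k t S i) ((fan k t S a).2 i 0) ((fan k t S b).2 i 0) := by
  obtain ⟨ha, hb, hne, hd, -⟩ := id hab
  have hfa := ha.isFan hk ht hS
  have hfb := hb.isFan hk ht hS
  have hsep : 2 * (3 / 2 * t) < dist a b := by linarith [ha.lt_dist ht hb hne]
  have hA := hfa.hub_mem_dist i
  have hB := hfb.hub_mem_dist i
  have hAB : ∀ j l, (fan k t S a).2 i j ≠ (fan k t S b).2 i l := by
    intro j l e
    have h1 := (hA j).2
    have h2 := (hB l).2
    rw [← e] at h2
    linarith [dist_triangle_left a b ((fan k t S a).2 i j)]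
  -- The bisector of the two sites separates the triangles and their centres. Genericity applies
  -- because hubs of either site are within 27t/2 + 3t/2 = 15t ≤ 20t of the other.
  obtain ⟨j, l, h1, h2⟩ := exists_mutual_inArc (u := b - a)
    (bisector_lt hfa.dist_center_le hsep) (fun j => bisector_lt (hA j).2 hsep)
    (lt_bisector hfb.dist_center_le hsep) (fun l => lt_bisector (hB l).2 hsep)
    (hfa.det_pos i) (hfb.det_pos i)
    (fun j l => hfa.generic _ (mem_localView.2 ⟨(hA j).1, by
        rw [dist_comm]; linarith [(hA j).2]⟩) _
      (mem_localView.2 ⟨(hB l).1, by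
        linarith [dist_triangle_right a ((fan k t S b).2 i l) b, (hB l).2]⟩) (hAB j l))
    (fun j l => hfb.generic _ (mem_localView.2 ⟨(hB l).1, by
        rw [dist_comm]; linarith [(hB l).2]⟩) _
      (mem_localView.2 ⟨(hA j).1, by
        linarith [dist_triangle_right b ((fan k t S a).2 i j) a, (hA j).2, dist_comm a b]⟩)
      (hAB j l).symm)
  have hbr : Edge k t S i ((fan k t S a).2 i j) ((fan k t S b).2 i l) :=
    Or.inr ⟨a, b, hab, ⟨j, rfl, (hA j).2, h1⟩, l, rfl, (hB l).2, h2⟩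
  exact ((ha.reach_hub hk ht hS j).tail hbr).trans (reach_symm (hb.reach_hub hk ht hS l))

/-- A closest pair of sites across a partition is a pair of neighbours. -/
lemma exists_siteAdj_cross (U : Set Plane)
    (h : ∃ a b, Site k t S a ∧ Site k t S b ∧ a ∈ U ∧ b ∉ U ∧ dist a b ≤ 27 / 2 * t) :
    ∃ a b, SiteAdj k t S a b ∧ a ∈ U ∧ b ∉ U := by
  obtain ⟨a, b, ha, hb, haU, hbU, hd⟩ := h
  set P : Set (Plane × Plane) :=
    {p | Site k t S p.1 ∧ Site k t S p.2 ∧ p.1 ∈ U ∧ p.2 ∉ U} with hP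
  have hfin : P.Finite := (S.finite_toSet.prod S.finite_toSet).subset fun p hp =>
    ⟨Site.mem hp.1, Site.mem hp.2.1⟩
  obtain ⟨⟨a', b'⟩, ⟨h1, h2, h3, h4⟩, hmin⟩ :=
    Set.exists_min_image P (fun p => dist p.1 p.2) hfin ⟨(a, b), ha, hb, haU, hbU⟩
  simp only at h1 h2 h3 h4
  refine ⟨a', b', ⟨h1, h2, fun e => h4 (e ▸ h3), (hmin (a, b) ⟨ha, hb, haU, hbU⟩).trans hd,
    fun d hs => ?_⟩, h3, h4⟩
  by_cases hdU : d ∈ U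
  · right
    rw [dist_comm b' d]
    exact hmin (d, b') ⟨hs, h2, hdU, h4⟩
  · left
    exact hmin (a', d) ⟨h1, hs, h3, hdU⟩

lemma reach_of_mem (hk : 1 ≤ k) (ht : 0 < t) (hS : GeneralPosition S)
    (hcov : ∀ y ∈ S, ∃ a, Site k t S a ∧ dist y a ≤ 9 * t)
    (hcross : ∀ (U : Set Plane) (a b : Plane), Site k t S a → Site k t S b → a ∈ U → b ∉ U →
      ∃ a b, Site k t S a ∧ Site k t S b ∧ a ∈ U ∧ b ∉ U ∧ dist a b ≤ 27 / 2 * t)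
    (hx : x ∈ S) (hy : y ∈ S) : ReflTransGen (Edge k t S i) x y := by
  obtain ⟨a, ha⟩ := exists_owns (hcov x hx)
  obtain ⟨b, hb⟩ := exists_owns (hcov y hy)
  refine (reach_symm (ha.reach hk ht hS hx)).trans (ReflTransGen.trans ?_ (hb.reach hk ht hS hy))
  by_contra hcon
  -- The partition consists of the sites whose first hub is reachable from that of `a`, and the
  -- remaining sites.
  obtain ⟨a', b', hadj, ha', hb'⟩ := exists_siteAdj_cross _ (hcross
    {s | ReflTransGen (Edge k t S i) ((fan k t S a).2 i 0) ((fan k t S s).2 i 0)} a b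
    ha.1.1 hb.1.1 ReflTransGen.refl hcon)
  exact hb' (ReflTransGen.trans ha' (hadj.reach hk ht hS))

end Connectedness

/-! ### Assembly of the layers and of the local rule. -/

/-- The graph of layer `i`. -/
def layer (k : ℕ) (t : ℝ) (S : Finset Plane) (i : Fin k) : SimpleGraph S where
  Adj x y := Edge k t S i x y
  symm := ⟨fun _ _ h => Edge.symm h⟩
  loopless := ⟨fun _ h => h.ne rfl⟩

lemma areLayers_layer {k : ℕ} {t : ℝ} {S : Finset Plane} (hk : 1 ≤ k) (ht : 0 < t)
    (hS : GeneralPosition S) (hne : S.Nonempty)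
    (hcov : ∀ y ∈ S, ∃ a, Site k t S a ∧ dist y a ≤ 9 * t)
    (hcross : ∀ (U : Set Plane) (a b : Plane), Site k t S a → Site k t S b → a ∈ U → b ∉ U →
      ∃ a b, Site k t S a ∧ Site k t S b ∧ a ∈ U ∧ b ∉ U ∧ dist a b ≤ 27 / 2 * t) :
    AreLayers (layer k t S) := by
  refine ⟨fun i => ?_, fun i => ?_, fun i j hij => ?_⟩
  · have : Nonempty S := hne.to_subtype
    refine SimpleGraph.Connected.mk fun x y => ?_
    have key : ∀ z, Relation.ReflTransGen (Edge k t S i) x z →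
        ∃ hz : z ∈ S, (layer k t S i).Reachable x ⟨z, hz⟩ := by
      intro z hz
      induction hz with
      | refl => exact ⟨x.2, SimpleGraph.Reachable.refl _⟩
      | tail _ he ih =>
        obtain ⟨hz, hr⟩ := ih
        refine ⟨(he.mem hk ht hS).2, hr.trans (SimpleGraph.Adj.reachable ?_)⟩
        exact he
    exact (key y (reach_of_mem hk ht hS hcov hcross x.2 y.2)).2
  · intro a b c d hab hcd hne z hz
    have h := Edge.inter hk ht hS hab hcd (z := z) (fun e => hne ?_) hz.1 hz.2
    · exact ⟨h.1, h.2⟩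
    · rw [Sym2.eq_iff] at e ⊢
      simpa only [Subtype.coe_inj] using e
  · rw [Set.disjoint_left]
    intro e
    induction e using Sym2.ind with
    | _ x y => exact fun h h' => hij (Edge.layer_eq hk ht hS h h')

/-- The rule that applies the global construction to the visible points. -/
def layerRule : LocalRule := fun k β visible p i => {q | Edge k (k * β) visible i p q}

lemma exists_layers {k : ℕ} {β : ℝ} {S : Finset Plane} (hk : 1 ≤ k) (hS : GeneralPosition S)
    (hcard : 4 * (3 * k - 1) + 1 ≤ S.card) {T : SimpleGraph S} (hT : IsMST T)
    (hb : bottleneck T ≤ β) :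
    AreLayers (layer k (k * β) S) ∧
      (∀ i, ∀ e ∈ (layer k (k * β) S i).edgeSet, edgeLength e ≤ 12 * √2 * k * β) ∧
      ComputedLocally layerRule β (1000 * k * β) (layer k (k * β) S) := by
  have hconn := hT.1.connected
  have hTβ : ∀ u v : S, T.Adj u v → dist (u : Plane) v ≤ β := fun u v h =>
    le_trans (le_csSup ((Set.toFinite T.edgeSet).image edgeLength).bddAbove
      ⟨s(u, v), h, rfl⟩) hb
  have hβ : 0 < β := by
    obtain ⟨u, hu, v, hv, huv⟩ := Finset.one_lt_card.1 (by omega : 1 < S.card)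
    have : Nontrivial S := ⟨⟨u, hu⟩, ⟨v, hv⟩, fun e => huv (congrArg Subtype.val e)⟩
    obtain ⟨w, hw⟩ := hconn.preconnected.exists_adj_of_nontrivial ⟨u, hu⟩
    exact lt_of_lt_of_le (dist_pos.2 fun e => hw.ne (Subtype.ext e)) (hTβ _ _ hw)
  have hk' : (1 : ℝ) ≤ k := by exact_mod_cast hk
  have ht : 0 < k * β := by positivity
  have hcard' : 3 * k ≤ S.card := by omega
  refine ⟨areLayers_layer hk ht hS (Finset.card_pos.1 (by omega)) (fun y hy => ?_)
    (fun U a b ha hb' haU hbU => exists_cross_pair hk hconn hTβ hβ U ha hb' haU hbU), ?_, ?_⟩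
  · obtain ⟨v, hv, hd⟩ := exists_dense_near hconn hTβ hβ.le hcard' ⟨y, hy⟩
    obtain ⟨a, ha, hd'⟩ := hv.exists_site ht
    exact ⟨a, ha, by linarith [dist_triangle y v a]⟩
  · intro i e
    induction e using Sym2.ind with
    | _ x y =>
      intro h
      have h1 : dist (x : Plane) y ≤ 33 / 2 * (k * β) := Edge.dist_le ht h
      -- 12 · 11/8 = 33/2, so this crude bound on √2 is exactly sufficient.
      have h2 : (11 / 8 : ℝ) ≤ √2 := Real.le_sqrt_of_sq_le (by norm_num)
      show dist (x : Plane) y ≤ _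
      nlinarith
  · intro i p q
    -- Edges at `p` depend only on points within `200 * (k * β)`, so the view radius 1000kβ
    -- suffices.
    exact Agree.edge_iff ht ((agree_localView (p : Plane) (1000 * k * β)).mono (by
      rw [dist_self]; nlinarith))

end PlaneLayers

open PlaneLayers in
theorem mainTheorem6 :
    (∀ (k : ℕ) (S : Finset Plane), 1 ≤ k → GeneralPosition S → 4 * (3 * k - 1) + 1 ≤ S.card →
      ∀ T : SimpleGraph S, IsMST T →
        ∃ H : Fin k → SimpleGraph S, AreLayers H ∧
          ∀ i, ∀ e ∈ (H i).edgeSet, edgeLength e ≤ 12 * √2 * k * bottleneck T) ∧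
    (∃ C : ℝ, 0 < C ∧ ∃ R : LocalRule,
      ∀ (k : ℕ) (β : ℝ) (S : Finset Plane), 1 ≤ k → GeneralPosition S →
        4 * (3 * k - 1) + 1 ≤ S.card →
        ∀ T : SimpleGraph S, IsMST T → bottleneck T ≤ β →
          ∃ H : Fin k → SimpleGraph S, AreLayers H ∧
            (∀ i, ∀ e ∈ (H i).edgeSet, edgeLength e ≤ 12 * √2 * k * β) ∧
            ComputedLocally R β (C * k * β) H) := by
  refine ⟨fun k S hk hS hcard T hT => ?_, 1000, by norm_num, layerRule,
    fun k β S hk hS hcard T hT hb => ⟨_, exists_layers hk hS hcard hT hb⟩⟩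
  obtain ⟨h1, h2, -⟩ := exists_layers hk hS hcard hT le_rfl
  exact ⟨_, h1, h2⟩
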